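/- Let $R$ be a countably infinite computable integral domain: there is a bijection $\phi : R \to \mathbb{N}$ such that the operations $(m,n)\mapsto\phi(\phi^{-1}(m)+\phi^{-1}(n))$ and $(m,n)\mapsto\phi(\phi^{-1}(m)\cdot\phi^{-1}(n))$ on $\mathbb{N}$ are computable. Polynomials $p \in \bigcup_{n\ge 1} R[x_1,\dots,x_n]$ (a disjoint union: $p$ remembers its number $n$ of variables) are coded by $n$ together with a finite list of terms, a term being the $\phi$-code of its coefficient together with its exponents; a set of polynomials is $\Sigma^0_k$ or $\Pi^0_k$ if the set of codes of its members is, in the lightface arithmetical hierarchy. For a cancellative commutative semigroup $S$, a (left) Følner sequence is a sequence $\mathcal F=(F_n)$ of nonempty finite subsets of $S$ with $|sF_n\triangle F_n|/|F_n|\to 0$ for every $s\in S$, and the upper Banach density of $A\subseteq S$ is $\sup_{\mathcal F}\limsup_n |A\cap F_n|/|F_n|$. For $B\subseteq R$ let $d^*(B)$ be the upper Banach density of $B$ in $(R,+)$ and $d^*_\times(B)$ that of $B\setminus\{0\}$ in $(R\setminus\{0\},\cdot)$. A root $(a_1,\dots,a_n)$ of $p$ is injective if $a_i\ne a_j$ for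 $i\neq j$, and it is contained in $B$ if all $a_i\in B$. Define the following sets of polynomials. - $H_R$: the homogeneous polynomials. $T_R$: those with $p(x_1+r,\dots,x_n+r)=p(x_1,\dots,x_n)$ for all $r\in R$. - For $\delta>0$, $IMDR_R(\delta)$ (resp. $IADR_R(\delta)$): those $p$ such that every $B\subseteq R$ with $d^*_\times(B)\ge\delta$ (resp. $d^*(B)\ge\delta$) contains an injective root of $p$. $IMDR_R=\bigcap_{\delta>0}IMDR_R(\delta)$ and $IADR_R=\bigcap_{\delta>0}IADR_R(\delta)$. - For $\ell\ge1$, $PR_R(\ell)$ (resp. $IPR_R(\ell)$): those $p$ such that for every partition $R\setminus\{0\}=\bigcup_{i=1}^{\ell}C_i$ some cell $C_i$ contains a root (resp. an injective root) of $p$. $PR_R=\bigcap_{\ell\ge1}PR_R(\ell)$ and $IPR_R=\bigcap_{\ell\ge1}IPR_R(\ell)$. Then: 1. For every real $\delta>0$ that is lower semicomputable, i.e. such that $\{(k,n)\in\mathbb{N}^2 : k<\delta n\}$ is computably enumerable (for example, every computable real $\delta>0$, in particular every rational one), the sets $IMDR_R(\delta)\cap H_R$ and $IADR_R(\delta)\cap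 T_R$ are $\Sigma^0_1$. 2. For every integer $\ell\ge 1$, the sets $PR_R(\ell)$ and $IPR_R(\ell)$ are $\Sigma^0_1$. 3. The sets $IMDR_R\cap H_R$, $IADR_R\cap T_R$, $PR_R$ and $IPR_R$ are $\Pi^0_2$. -/

import Mathlib

open scoped symmDiff nonZeroDivisors

namespace RamseyComplexity

/-! ### The lightface (arithmetical) hierarchy -/

/-- Lightface `Σ⁰ₙ` subsets of a coded type: `Σ⁰₀` is the class of computable sets, and `A` is
`Σ⁰ₙ₊₁` if it is the projection along `ℕ` of a set whose complement is `Σ⁰ₙ`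
(that is, of a `Π⁰ₙ` set). -/
def IsSigmaZero : ℕ → {α : Type} → [Primcodable α] → Set α → Prop
  | 0, _, _, A => ComputablePred (fun a => a ∈ A)
  | n + 1, α, _, A =>
      ∃ B : Set (α × ℕ), IsSigmaZero n Bᶜ ∧ ∀ a, a ∈ A ↔ ∃ m : ℕ, (a, m) ∈ B

/-- Lightface `Π⁰ₙ` sets are the complements of `Σ⁰ₙ` sets. -/
def IsPiZero (n : ℕ) {α : Type} [Primcodable α] (A : Set α) : Prop :=
  IsSigmaZero n Aᶜ

/-- A real `δ` is lower semicomputable (left-c.e.) if the set of pairs `(k, n)` with `k < δ n`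
is `Σ⁰₁`; for `δ > 0` this says that the set of nonnegative rationals `k / n` below `δ` is
computably enumerable. -/
def IsLowerSemicomputable (δ : ℝ) : Prop :=
  IsSigmaZero 1 {q : ℕ × ℕ | (q.1 : ℝ) < δ * (q.2 : ℝ)}

/-! ### Computable rings and codes of polynomials -/

/-- The bijection `φ : R ≃ ℕ` is a computable presentation of the ring `R`: addition and
multiplication, transported to `ℕ` along `φ`, are computable. -/
def IsComputablePresentation {R : Type*} [CommRing R] (φ : R ≃ ℕ) : Prop :=
  Computable₂ (fun m n : ℕ => φ (φ.symm m + φ.symm n)) ∧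
    Computable₂ (fun m n : ℕ => φ (φ.symm m * φ.symm n))

/-- The disjoint union over `n ≥ 1` of the rings `R[x₁, …, xₙ]`; the index is `k = n - 1`. -/
abbrev Poly (R : Type*) [CommRing R] : Type _ :=
  Σ k : ℕ, MvPolynomial (Fin (k + 1)) R

/-- A code of a polynomial: `(k, L)`, where `L` is a list of terms
`(code of a coefficient, list of exponents)`. -/
abbrev PolyCode : Type := ℕ × List (ℕ × List ℕ)

/-- The polynomial in `k + 1` variables with code `(k, L)`: the sum of the terms in `L`.
Missing exponents are `0`, superfluous ones are ignored. -/
noncomputable def polyOfCode {R : Type*} [CommRing R] (φ : R ≃ ℕ) (c : PolyCode) : Poly R :=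
  ⟨c.1, (c.2.map fun t => MvPolynomial.monomial
    (Finsupp.equivFunOnFinite.symm fun i : Fin (c.1 + 1) => t.2.getD (i : ℕ) 0)
    (φ.symm t.1)).sum⟩

/-- Every polynomial has a code. -/
theorem polyOfCode_surjective {R : Type*} [CommRing R] (φ : R ≃ ℕ) :
    Function.Surjective (polyOfCode φ) := by
  rintro ⟨k, p⟩
  refine ⟨(k, p.support.toList.map fun m => (φ (p.coeff m), List.ofFn fun i => m i)), ?_⟩
  simp only [polyOfCode, List.map_map, Sigma.mk.injEq, heq_eq_eq, true_and]
  conv_rhs => rw [p.as_sum]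
  rw [← Finset.sum_map_toList]
  congr 1
  apply List.map_congr_left
  intro m _
  simp only [Function.comp_apply, Equiv.symm_apply_apply]
  have h : (Finsupp.equivFunOnFinite.symm fun i : Fin (k + 1) =>
      (List.ofFn fun i => m i).getD (i : ℕ) 0) = m := by
    ext i
    have hi : (i : ℕ) ≤ k := Nat.lt_succ_iff.mp i.2
    simp [List.getD_eq_getElem?_getD, -List.ofFn_succ, hi]
  rw [h]

/-- A set of polynomials over `R` is `Σ⁰ₙ` (with respect to `φ`) if the set of all codes of its
members is `Σ⁰ₙ`. -/
def IsSigmaZeroPoly {R : Type*} [CommRing R] (φ : R ≃ ℕ) (n : ℕ) (P : Set (Poly R)) : Prop :=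
  IsSigmaZero n (polyOfCode φ ⁻¹' P)

/-- A set of polynomials over `R` is `Π⁰ₙ` (with respect to `φ`) if the set of all codes of its
members is `Π⁰ₙ`. -/
def IsPiZeroPoly {R : Type*} [CommRing R] (φ : R ≃ ℕ) (n : ℕ) (P : Set (Poly R)) : Prop :=
  IsPiZero n (polyOfCode φ ⁻¹' P)

/-! ### Følner sequences and upper Banach density -/

open Classical in
/-- `F` is a left Følner sequence of nonempty finite subsets of the semigroup `S`. -/
def IsLeftFolner {S : Type*} [Semigroup S] (F : ℕ → Finset S) : Prop :=
  (∀ n, (F n).Nonempty) ∧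
    ∀ s : S, Filter.Tendsto
      (fun n => ((((F n).image (fun x => s * x)) ∆ (F n)).card : ℝ) / ((F n).card : ℝ))
      Filter.atTop (nhds 0)

open Classical in
/-- The upper density of `A` along the sequence `F` of finite sets. -/
noncomputable def upperDensity {S : Type*} (F : ℕ → Finset S) (A : Set S) : ℝ :=
  Filter.limsup (fun n => (((F n).filter (fun x => x ∈ A)).card : ℝ) / ((F n).card : ℝ))
    Filter.atTop

/-- The upper Banach density of `A` in the semigroup `S`. -/
noncomputable def upperBanachDensity {S : Type*} [Semigroup S] (A : Set S) : ℝ :=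
  sSup {d : ℝ | ∃ F : ℕ → Finset S, IsLeftFolner F ∧ d = upperDensity F A}

/-- `d*(B)`: the upper Banach density of `B ⊆ R` in the group `(R, +)`. -/
noncomputable def addDensity {R : Type*} [CommRing R] (B : Set R) : ℝ :=
  upperBanachDensity (S := Multiplicative R) (Multiplicative.toAdd ⁻¹' B)

/-- `d*_×(B)`: the upper Banach density of `B \ {0}` in the semigroup `(R \ {0}, ·)`
(for an integral domain, `R⁰` is `R \ {0}`). -/
noncomputable def mulDensity {R : Type*} [CommRing R] (B : Set R) : ℝ :=
  upperBanachDensity (S := R⁰) ((fun x : R⁰ => (x : R)) ⁻¹' B)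

/-! ### The sets of polynomials -/

/-- `B` contains a root of `p`. -/
def ContainsRoot {R : Type*} [CommRing R] (p : Poly R) (B : Set R) : Prop :=
  ∃ a : Fin (p.1 + 1) → R, (∀ i, a i ∈ B) ∧ MvPolynomial.eval a p.2 = 0

/-- `B` contains an injective root of `p`, i.e. one with pairwise distinct coordinates. -/
def ContainsInjectiveRoot {R : Type*} [CommRing R] (p : Poly R) (B : Set R) : Prop :=
  ∃ a : Fin (p.1 + 1) → R,
    Function.Injective a ∧ (∀ i, a i ∈ B) ∧ MvPolynomial.eval a p.2 = 0

/-- `H_R`: the homogeneous polynomials. -/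
def H (R : Type*) [CommRing R] : Set (Poly R) :=
  {p | ∃ d : ℕ, p.2.IsHomogeneous d}

/-- `T_R`: the polynomials with `p(x₁ + r, …, xₙ + r) = p(x₁, …, xₙ)` for all `r ∈ R`. -/
def T (R : Type*) [CommRing R] : Set (Poly R) :=
  {p | ∀ r : R,
    MvPolynomial.aeval (fun i => MvPolynomial.X i + MvPolynomial.C r) p.2 = p.2}

/-- `IMDR_R(δ)`. -/
def IMDRAt (R : Type*) [CommRing R] (δ : ℝ) : Set (Poly R) :=
  {p | ∀ B : Set R, δ ≤ mulDensity B → ContainsInjectiveRoot p B}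

/-- `IADR_R(δ)`. -/
def IADRAt (R : Type*) [CommRing R] (δ : ℝ) : Set (Poly R) :=
  {p | ∀ B : Set R, δ ≤ addDensity B → ContainsInjectiveRoot p B}

/-- `IMDR_R`, the intersection of all `IMDR_R(δ)` with `δ > 0`. -/
def IMDR (R : Type*) [CommRing R] : Set (Poly R) :=
  {p | ∀ δ : ℝ, 0 < δ → p ∈ IMDRAt R δ}

/-- `IADR_R`, the intersection of all `IADR_R(δ)` with `δ > 0`. -/
def IADR (R : Type*) [CommRing R] : Set (Poly R) :=
  {p | ∀ δ : ℝ, 0 < δ → p ∈ IADRAt R δ}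

/-- `C` is a partition of `R \ {0}` into `ℓ` cells. -/
def IsPartitionNonzero {R : Type*} [CommRing R] {ℓ : ℕ} (C : Fin ℓ → Set R) : Prop :=
  (⋃ i, C i) = {x : R | x ≠ 0} ∧ ∀ i j, i ≠ j → Disjoint (C i) (C j)

/-- `PR_R(ℓ)`: the polynomials `p` for which `p = 0` is `ℓ`-partition regular over `R \ {0}`. -/
def PRAt (R : Type*) [CommRing R] (ℓ : ℕ) : Set (Poly R) :=
  {p | ∀ C : Fin ℓ → Set R, IsPartitionNonzero C → ∃ i, ContainsRoot p (C i)}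

/-- `IPR_R(ℓ)`: the polynomials `p` for which `p = 0` is injectively `ℓ`-partition regular over
`R \ {0}`. -/
def IPRAt (R : Type*) [CommRing R] (ℓ : ℕ) : Set (Poly R) :=
  {p | ∀ C : Fin ℓ → Set R, IsPartitionNonzero C → ∃ i, ContainsInjectiveRoot p (C i)}

/-- `PR_R`, the intersection of all `PR_R(ℓ)` with `ℓ ≥ 1`. -/
def PR (R : Type*) [CommRing R] : Set (Poly R) :=
  {p | ∀ ℓ : ℕ, 1 ≤ ℓ → p ∈ PRAt R ℓ}

/-- `IPR_R`, the intersection of all `IPR_R(ℓ)` with `ℓ ≥ 1`. -/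
def IPR (R : Type*) [CommRing R] : Set (Poly R) :=
  {p | ∀ ℓ : ℕ, 1 ≤ ℓ → p ∈ IPRAt R ℓ}

end RamseyComplexity

/-! ### Computability of list operations -/

namespace Computable

variable {α β σ : Type*} [Primcodable α] [Primcodable β] [Primcodable σ]

/-! Each regularity property quantifies over arbitrary subsets or partitions of `R`. Compactness
replaces it by the existence of one finite object whose correctness is a `Σ⁰₁` condition, uniformly
in the code and the parameter.

For partitions (`forall_partition_iff`), a limit along an ultrafilter of bad colourings of the first
`N` elements is a bad colouring of everything, so regularity is already visible for some `N`.

For densities, homogeneity (resp. translation invariance) makes the injective roots stable under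
multiplication (resp. addition), so both cases concern an invariant family `E` of tuples in a
countable commutative cancellative monoid. By `forall_density_iff_exists_list` the witness is a
finite list `L` all of whose `δ`-dense sublists contain a member of `E`. Given `L`, averaging along
a Følner sequence yields a translate of `L` having at least the fraction `δ` in the given set.
Conversely, suppose that each Følner set `F n` has a dense `E`-free subset `B n`. Translating `B n`
by a uniform random point of `F n` gives measures on `S → Bool`. A limit measure gives every
coordinate mass at least `δ` and every member of `E` mass zero, and the reverse Fatou lemma extracts
one `E`-free set of density at least `δ`, with no loss in the threshold.

Evaluation of coded polynomials is computable, and `H` and `T` are recognised by testing identities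
on finite grids. A lower semicomputable `δ` suffices because `δ` occurs only through the `Σ⁰₁`
alternative `|B| < δ |L|`. Intersecting over `δ = 1 / (n + 1)`, or over all `ℓ`, puts one universal
quantifier in front and gives `Π⁰₂`. -/

theorem list_foldl {f : α → List β} {g : α → σ} {h : α → σ × β → σ}
    (hf : Computable f) (hg : Computable g) (hh : Computable₂ h) :
    Computable fun a => (f a).foldl (fun s b => h a (s, b)) (g a) := by
  -- One step of the fold, driven by a counter; past the end of the list the lookup is `none` and
  -- the state stays put.
  have hstep : Computable₂ fun (a : α) (p : ℕ × σ) =>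
      (Option.casesOn ((f a)[p.1]?) p.2 (fun b => h a (p.2, b)) : σ) := by
    refine Computable.option_casesOn (o := fun q : α × ℕ × σ => (f q.1)[q.2.1]?)
      (f := fun q => q.2.2) (g := fun q b => h q.1 (q.2.2, b)) ?_ (snd.comp snd) ?_
    · exact list_getElem?.comp (hf.comp fst) (fst.comp snd)
    · exact hh.comp (fst.comp fst) ((snd.comp (snd.comp fst)).pair snd)
  refine (Computable.nat_rec (list_length.comp hf) hg hstep).of_eq fun a => ?_
  have key : ∀ n : ℕ, (Nat.rec (motive := fun _ => σ) (g a)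
      (fun y IH => (Option.casesOn ((f a)[y]?) IH (fun b => h a (IH, b)) : σ)) n) =
      ((f a).take n).foldl (fun s b => h a (s, b)) (g a) := by
    intro n
    induction n with
    | zero => simp
    | succ n ih =>
      have hopt : ∀ (o : Option β) (s : σ), (Option.casesOn o s (fun b => h a (s, b)) : σ) =
          o.toList.foldl (fun s b => h a (s, b)) s := by
        rintro (_ | b) s <;> rfl
      rw [List.take_add_one, List.foldl_append, ← ih]
      exact hopt _ _
  rw [key, List.take_length]

theorem list_foldr {f : α → List β} {g : α → σ} {h : α → β × σ → σ}
    (hf : Computable f) (hg : Computable g) (hh : Computable₂ h) :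
    Computable fun a => (f a).foldr (fun b s => h a (b, s)) (g a) := by
  have h' : Computable₂ fun (a : α) (p : σ × β) => h a (p.2, p.1) :=
    hh.comp fst ((snd.comp snd).pair (fst.comp snd))
  refine (list_foldl (list_reverse.comp hf) hg h').of_eq fun a => ?_
  simp

end Computable

theorem Primrec.list_sublists' {α : Type*} [Primcodable α] :
    Primrec (List.sublists' : List α → List (List α)) := by
  have h : Primrec₂ fun (_ : List α) (p : α × List (List α)) =>
      p.2 ++ p.2.map (fun l => p.1 :: l) := by
    refine Primrec.list_append.comp (Primrec.snd.comp Primrec.snd)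
      (Primrec.list_map (Primrec.snd.comp Primrec.snd) ?_)
    exact Primrec.list_cons.comp (Primrec.fst.comp (Primrec.snd.comp Primrec.fst)) Primrec.snd
  refine (Primrec.list_foldr Primrec.id (Primrec.const [[]]) h).of_eq fun l => ?_
  induction l with
  | nil => rfl
  | cons a l ih => rw [List.sublists'_cons, ← ih]; rfl

/-- The list of all words of length `n` over the alphabet `l`. -/
def List.words {α : Type*} (l : List α) (n : ℕ) : List (List α) :=
  Nat.rec [[]] (fun _ ws => ws.flatMap fun w => l.map fun a => a :: w) n

theorem List.mem_words {α : Type*} {l : List α} {n : ℕ} {w : List α} :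
    w ∈ l.words n ↔ w.length = n ∧ ∀ a ∈ w, a ∈ l := by
  induction n generalizing w with
  | zero => cases w <;> simp [List.words]
  | succ n ih =>
    have : l.words (n + 1) = (l.words n).flatMap fun w => l.map fun a => a :: w := rfl
    rw [this]
    cases w with
    | nil => simp
    | cons b w =>
      simp only [List.mem_flatMap, List.mem_map, List.cons.injEq, ih, List.length_cons,
        List.mem_cons, forall_eq_or_imp]
      constructor
      · rintro ⟨w', ⟨h1, h2⟩, a, ha, rfl, rfl⟩
        exact ⟨by omega, ha, h2⟩
      · rintro ⟨h1, h2, h3⟩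
        exact ⟨w, ⟨by omega, h3⟩, b, h2, rfl, rfl⟩

theorem Primrec.list_words {α : Type*} [Primcodable α] :
    Primrec₂ (List.words : List α → ℕ → List (List α)) := by
  refine Primrec.nat_rec' (f := fun p : List α × ℕ => p.2) (g := fun _ => [[]])
    (h := fun p q => q.2.flatMap fun w => p.1.map fun a => a :: w) Primrec.snd
    (Primrec.const _) ?_
  refine Primrec.list_flatMap (Primrec.snd.comp Primrec.snd) ?_
  refine Primrec.list_map (Primrec.fst.comp (Primrec.fst.comp Primrec.fst)) ?_
  exact Primrec.list_cons.comp Primrec.snd (Primrec.snd.comp Primrec.fst)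

/-! ### Closure properties of computable predicates -/

namespace ComputablePred

variable {α β : Type*} [Primcodable α] [Primcodable β]

theorem comp {p : β → Prop} {f : α → β} (hp : ComputablePred p) (hf : Computable f) :
    ComputablePred fun a => p (f a) := by
  obtain ⟨_, h⟩ := hp
  exact ⟨inferInstance, h.comp hf⟩

theorem and {p q : α → Prop} (hp : ComputablePred p) (hq : ComputablePred q) :
    ComputablePred fun a => p a ∧ q a := by
  obtain ⟨_, hp⟩ := hp
  obtain ⟨_, hq⟩ := hq
  refine ⟨inferInstance, (Primrec.and.to_comp.comp hp hq).of_eq fun a => ?_⟩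
  simp

theorem or {p q : α → Prop} (hp : ComputablePred p) (hq : ComputablePred q) :
    ComputablePred fun a => p a ∨ q a :=
  (hp.not.and hq.not).not.of_eq fun a => by tauto

theorem imp {p q : α → Prop} (hp : ComputablePred p) (hq : ComputablePred q) :
    ComputablePred fun a => p a → q a :=
  (hp.not.or hq).of_eq fun a => by tauto

theorem eq {f g : α → β} (hf : Computable f) (hg : Computable g) :
    ComputablePred fun a => f a = g a :=
  (Primrec.eq (α := β)).computablePred.comp (hf.pair hg)

theorem lt {f g : α → ℕ} (hf : Computable f) (hg : Computable g) :
    ComputablePred fun a => f a < g a :=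
  Primrec.nat_lt.computablePred.comp (hf.pair hg)

theorem forall_mem_list {p : α × β → Prop} {L : α → List β} (hp : ComputablePred p)
    (hL : Computable L) : ComputablePred fun a => ∀ b ∈ L a, p (a, b) := by
  obtain ⟨_, hp⟩ := hp
  have h : Computable₂ fun (a : α) (q : Bool × β) => q.1 && decide (p (a, q.2)) :=
    Primrec.and.to_comp.comp (Computable.fst.comp Computable.snd)
      (hp.comp (Computable.fst.pair (Computable.snd.comp Computable.snd)))
  classical
  refine ⟨inferInstance, (Computable.list_foldl hL (Computable.const true) h).of_eq fun a => ?_⟩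
  have key : ∀ (l : List β) (c : Bool), l.foldl (fun s b => s && decide (p (a, b))) c =
      (c && decide (∀ b ∈ l, p (a, b))) := by
    intro l
    induction l with
    | nil => simp
    | cons b l ih =>
      intro c
      rw [List.foldl_cons, ih]
      simp [Bool.and_assoc]
  simpa using key (L a) true

theorem exists_mem_list {p : α × β → Prop} {L : α → List β} (hp : ComputablePred p)
    (hL : Computable L) : ComputablePred fun a => ∃ b ∈ L a, p (a, b) :=
  (hp.not.forall_mem_list hL).not.of_eq fun a => by simp

theorem mem_list {f : α → β} {L : α → List β} (hf : Computable f) (hL : Computable L) :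
    ComputablePred fun a => f a ∈ L a :=
  (exists_mem_list (p := fun q : α × β => f q.1 = q.2)
    (eq (hf.comp Computable.fst) Computable.snd) hL).of_eq fun a => by simp

theorem nodup {L : α → List β} (hL : Computable L) : ComputablePred fun a => (L a).Nodup := by
  have h1 : ComputablePred fun q : (α × ℕ) × ℕ =>
      q.1.2 < q.2 → (L q.1.1)[q.1.2]? ≠ (L q.1.1)[q.2]? := by
    refine (lt (Computable.snd.comp Computable.fst) Computable.snd).imp (ComputablePred.not ?_)
    have hL' : Computable fun q : (α × ℕ) × ℕ => L q.1.1 :=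
      hL.comp (Computable.fst.comp Computable.fst)
    exact eq (Computable.list_getElem?.comp hL' (Computable.snd.comp Computable.fst))
      (Computable.list_getElem?.comp hL' Computable.snd)
  have hr : Computable fun a => List.range (L a).length :=
    Primrec.list_range.to_comp.comp (Computable.list_length.comp hL)
  refine ((h1.forall_mem_list (hr.comp Computable.fst)).forall_mem_list hr).of_eq fun a => ?_
  rw [List.nodup_iff_getElem?_ne_getElem?]
  simp only [List.mem_range]
  exact ⟨fun h i j hij hj => h i (by omega) j hj hij, fun h i _ j hj hij => h i j hij hj⟩

end ComputablePred

namespace RamseyComplexity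

/-! ### Closure properties of `Σ⁰₁` predicates -/

/-- `Σ⁰₁` predicates. -/
def SigmaOne {α : Type} [Primcodable α] (p : α → Prop) : Prop :=
  IsSigmaZero 1 {a | p a}

namespace SigmaOne

variable {α β : Type} [Primcodable α] [Primcodable β]

theorem iff_exists {p : α → Prop} : SigmaOne p ↔
    ∃ q : α × ℕ → Prop, ComputablePred q ∧ ∀ a, p a ↔ ∃ m, q (a, m) := by
  constructor
  · rintro ⟨B, hB, h⟩
    exact ⟨fun x => x ∈ B, (ComputablePred.not hB).of_eq fun a => by simp, h⟩
  · rintro ⟨q, hq, h⟩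
    exact ⟨{x | q x}, hq.not, h⟩

theorem of_eq {p q : α → Prop} (hp : SigmaOne p) (h : ∀ a, p a ↔ q a) : SigmaOne q :=
  (funext fun a => propext (h a) : p = q) ▸ hp

theorem of_computablePred {p : α → Prop} (hp : ComputablePred p) : SigmaOne p :=
  iff_exists.2 ⟨fun x => p x.1, hp.comp Computable.fst, fun a => by simp⟩

theorem comp {p : β → Prop} {f : α → β} (hp : SigmaOne p) (hf : Computable f) :
    SigmaOne fun a => p (f a) := by
  obtain ⟨q, hq, h⟩ := iff_exists.1 hp
  exact iff_exists.2 ⟨fun x => q (f x.1, x.2),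
    hq.comp ((hf.comp Computable.fst).pair Computable.snd), fun a => h (f a)⟩

theorem and {p q : α → Prop} (hp : SigmaOne p) (hq : SigmaOne q) :
    SigmaOne fun a => p a ∧ q a := by
  obtain ⟨p', hp', h⟩ := iff_exists.1 hp
  obtain ⟨q', hq', h'⟩ := iff_exists.1 hq
  have hu := Computable.unpair.comp (Computable.snd (α := α) (β := ℕ))
  refine iff_exists.2 ⟨fun x => p' (x.1, x.2.unpair.1) ∧ q' (x.1, x.2.unpair.2),
    (hp'.comp (Computable.fst.pair (Computable.fst.comp hu))).and
      (hq'.comp (Computable.fst.pair (Computable.snd.comp hu))), fun a => ?_⟩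
  rw [h, h']
  constructor
  · rintro ⟨⟨m, hm⟩, n, hn⟩
    exact ⟨Nat.pair m n, by simpa using ⟨hm, hn⟩⟩
  · rintro ⟨m, h1, h2⟩
    exact ⟨⟨_, h1⟩, _, h2⟩

theorem or {p q : α → Prop} (hp : SigmaOne p) (hq : SigmaOne q) :
    SigmaOne fun a => p a ∨ q a := by
  obtain ⟨p', hp', h⟩ := iff_exists.1 hp
  obtain ⟨q', hq', h'⟩ := iff_exists.1 hq
  exact iff_exists.2 ⟨fun x => p' x ∨ q' x, hp'.or hq', fun a => by rw [h, h', exists_or]⟩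

theorem exists_nat {p : α × ℕ → Prop} (hp : SigmaOne p) : SigmaOne fun a => ∃ n, p (a, n) := by
  obtain ⟨q, hq, h⟩ := iff_exists.1 hp
  have hu := Computable.unpair.comp (Computable.snd (α := α) (β := ℕ))
  refine iff_exists.2 ⟨fun x => q ((x.1, x.2.unpair.1), x.2.unpair.2), hq.comp
    ((Computable.fst.pair (Computable.fst.comp hu)).pair (Computable.snd.comp hu)), fun a => ?_⟩
  simp only [h]
  constructor
  · rintro ⟨n, m, hm⟩
    exact ⟨Nat.pair n m, by simpa using hm⟩
  · rintro ⟨m, h1⟩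
    exact ⟨_, _, h1⟩

/-- A search through all natural numbers, in which those that decode to nothing are rejected. -/
theorem exists_codable {p : α × β → Prop} (hp : SigmaOne p) : SigmaOne fun a => ∃ b, p (a, b) := by
  obtain ⟨q, hq, h⟩ := iff_exists.1 hp
  have hd : Computable fun x : (α × ℕ) × ℕ => (Encodable.decode x.1.2 : Option β) :=
    Computable.decode.comp (Computable.snd.comp Computable.fst)
  have hc : SigmaOne fun x : α × ℕ => ∃ m, ∃ b, Encodable.decode x.2 = some b ∧ q ((x.1, b), m) := by
    obtain ⟨_, hq⟩ := hq
    refine exists_nat (p := fun y : (α × ℕ) × ℕ =>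
      ∃ b, Encodable.decode y.1.2 = some b ∧ q ((y.1.1, b), y.2)) (of_computablePred ?_)
    have : Computable fun x : (α × ℕ) × ℕ => (Option.casesOn (Encodable.decode x.1.2 : Option β)
        false (fun b => decide (q ((x.1.1, b), x.2))) : Bool) :=
      Computable.option_casesOn hd (Computable.const false)
        (hq.comp (((Computable.fst.comp (Computable.fst.comp Computable.fst)).pair
          Computable.snd).pair (Computable.snd.comp Computable.fst)))
    refine (ComputablePred.eq this (Computable.const true)).of_eq fun x => ?_
    cases (Encodable.decode x.1.2 : Option β) <;> simp
  refine (exists_nat hc).of_eq fun a => ?_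
  constructor
  · rintro ⟨n, m, b, -, hb⟩
    exact ⟨b, (h _).2 ⟨m, hb⟩⟩
  · rintro ⟨b, hb⟩
    obtain ⟨m, hm⟩ := (h _).1 hb
    exact ⟨Encodable.encode b, m, b, by simp, hm⟩

/-- Finitely many witnesses have a common bound, so a single existential over that bound can be
moved in front of the bounded quantifier. -/
theorem forall_mem_list {p : α × β → Prop} {L : α → List β} (hp : SigmaOne p)
    (hL : Computable L) : SigmaOne fun a => ∀ b ∈ L a, p (a, b) := by
  obtain ⟨q, hq, h⟩ := iff_exists.1 hp
  have h1 : ComputablePred fun x : (α × ℕ) × β => ∃ m ∈ List.range x.1.2, q ((x.1.1, x.2), m) := by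
    refine ComputablePred.exists_mem_list
      (p := fun y : ((α × ℕ) × β) × ℕ => q ((y.1.1.1, y.1.2), y.2)) (hq.comp ?_)
      (Primrec.list_range.to_comp.comp (Computable.snd.comp Computable.fst))
    exact ((Computable.fst.comp (Computable.fst.comp Computable.fst)).pair
      (Computable.snd.comp Computable.fst)).pair Computable.snd
  refine iff_exists.2 ⟨_, h1.forall_mem_list (hL.comp Computable.fst), fun a => ?_⟩
  simp only [h, List.mem_range]
  generalize L a = l
  constructor
  · intro H
    induction l with
    | nil => exact ⟨0, by simp⟩
    | cons b l ih =>
      obtain ⟨M, hM⟩ := ih fun c hc => H c (List.mem_cons_of_mem _ hc)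
      obtain ⟨m, hm⟩ := H b List.mem_cons_self
      refine ⟨max M (m + 1), fun c hc => ?_⟩
      rcases List.mem_cons.1 hc with rfl | hc
      · exact ⟨m, by omega, hm⟩
      · obtain ⟨k, hk, hk'⟩ := hM c hc
        exact ⟨k, by omega, hk'⟩
  · rintro ⟨M, hM⟩ b hb
    obtain ⟨m, -, hm⟩ := hM b hb
    exact ⟨m, hm⟩

end SigmaOne

theorem isPiZero_two_of_forall {α : Type} [Primcodable α] {A : Set α} {p : α × ℕ → Prop}
    (hp : SigmaOne p) (h : ∀ a, a ∈ A ↔ ∀ n, p (a, n)) : IsPiZero 2 A := by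
  refine ⟨{x | ¬ p x}, ?_, fun a => ?_⟩
  · have : {x : α × ℕ | ¬ p x}ᶜ = {x | p x} := by ext; simp
    rw [this]; exact hp
  · simp [h]

end RamseyComplexity

namespace RamseyComplexity

variable {R : Type*} {φ : R ≃ ℕ} {α β : Type*} [Primcodable α] [Primcodable β]

/-! ### Ring-valued computable functions -/

/-- The function `f` with values in the ring `R` presented by `φ` is computable. -/
def RComputable (φ : R ≃ ℕ) (f : α → R) : Prop :=
  Computable fun a => φ (f a)

namespace RComputable

theorem comp {f : β → R} {g : α → β} (hf : RComputable φ f) (hg : Computable g) :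
    RComputable φ fun a => f (g a) :=
  Computable.comp (f := fun b => φ (f b)) hf hg

theorem const (r : R) : RComputable φ fun _ : α => r :=
  Computable.const _

theorem symm {f : α → ℕ} (hf : Computable f) : RComputable φ fun a => φ.symm (f a) :=
  hf.of_eq fun a => by simp

theorem eq {f g : α → R} (hf : RComputable φ f) (hg : RComputable φ g) :
    ComputablePred fun a => f a = g a :=
  (ComputablePred.eq hf hg).of_eq fun a => by simp

variable [CommRing R]

theorem add (hφ : IsComputablePresentation φ) {f g : α → R} (hf : RComputable φ f)
    (hg : RComputable φ g) : RComputable φ fun a => f a + g a :=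
  (hφ.1.comp hf hg).of_eq fun a => by simp

theorem mul (hφ : IsComputablePresentation φ) {f g : α → R} (hf : RComputable φ f)
    (hg : RComputable φ g) : RComputable φ fun a => f a * g a :=
  (hφ.2.comp hf hg).of_eq fun a => by simp

theorem pow (hφ : IsComputablePresentation φ) {f : α → R} {n : α → ℕ} (hf : RComputable φ f)
    (hn : Computable n) : RComputable φ fun a => f a ^ n a := by
  have h : Computable₂ fun (a : α) (p : ℕ × ℕ) => φ (φ.symm p.2 * f a) :=
    mul hφ (symm (Computable.snd.comp Computable.snd)) (hf.comp Computable.fst)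
  refine (Computable.nat_rec hn (Computable.const (φ 1)) h).of_eq fun a => ?_
  beta_reduce
  induction n a with
  | zero => simp
  | succ n ih => simp [pow_succ, ih]

theorem list_sum (hφ : IsComputablePresentation φ) {f : α × β → R} {L : α → List β}
    (hf : RComputable φ f) (hL : Computable L) :
    RComputable φ fun a => ((L a).map fun b => f (a, b)).sum := by
  have h : Computable₂ fun (a : α) (p : β × ℕ) => φ (f (a, p.1) + φ.symm p.2) :=
    add hφ (hf.comp (Computable.fst.pair (Computable.fst.comp Computable.snd)))
      (symm (Computable.snd.comp Computable.snd))
  refine (Computable.list_foldr hL (Computable.const (φ 0)) h).of_eq fun a => ?_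
  beta_reduce
  induction L a with
  | nil => simp
  | cons n l ih => simp [ih]

theorem list_prod (hφ : IsComputablePresentation φ) {f : α × β → R} {L : α → List β}
    (hf : RComputable φ f) (hL : Computable L) :
    RComputable φ fun a => ((L a).map fun b => f (a, b)).prod := by
  have h : Computable₂ fun (a : α) (p : β × ℕ) => φ (f (a, p.1) * φ.symm p.2) :=
    mul hφ (hf.comp (Computable.fst.pair (Computable.fst.comp Computable.snd)))
      (symm (Computable.snd.comp Computable.snd))
  refine (Computable.list_foldr hL (Computable.const (φ 1)) h).of_eq fun a => ?_
  beta_reduce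
  induction L a with
  | nil => simp
  | cons n l ih => simp [ih]

end RComputable

variable [CommRing R]

/-! ### Evaluation of codes of polynomials -/

/-- The value at `v` of the polynomial with code `c`. -/
def evalCode (φ : R ≃ ℕ) (c : PolyCode) (v : ℕ → R) : R :=
  (c.2.map fun t => φ.symm t.1 *
    ((List.range (c.1 + 1)).map fun i => v i ^ t.2.getD i 0).prod).sum

theorem eval_polyOfCode (c : PolyCode) (v : ℕ → R) :
    MvPolynomial.eval (fun i : Fin (c.1 + 1) => v i) (polyOfCode φ c).2 = evalCode φ c v := by
  simp only [polyOfCode, evalCode, map_list_sum, List.map_map]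
  congr 1
  refine List.map_congr_left fun t _ => ?_
  simp only [Function.comp_apply, MvPolynomial.eval_monomial]
  congr 1
  rw [Finsupp.prod_fintype _ _ (by simp)]
  simp only [Finsupp.equivFunOnFinite_symm_apply_apply]
  rw [← List.prod_toFinset _ List.nodup_range, List.toFinset_range,
    ← Fin.prod_univ_eq_prod_range (fun i => v i ^ t.2.getD i 0)]

theorem RComputable.evalCode (hφ : IsComputablePresentation φ) {C : α → PolyCode}
    {v : α → ℕ → R} (hC : Computable C) (hv : RComputable φ fun x : α × ℕ => v x.1 x.2) :
    RComputable φ fun a => evalCode φ (C a) (v a) := by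
  refine list_sum hφ (f := fun x : α × ℕ × List ℕ => φ.symm x.2.1 *
    ((List.range ((C x.1).1 + 1)).map fun i => v x.1 i ^ x.2.2.getD i 0).prod) ?_
    (Computable.snd.comp hC)
  refine mul hφ (symm (Computable.fst.comp Computable.snd)) ?_
  refine list_prod hφ (f := fun y : (α × ℕ × List ℕ) × ℕ => v y.1.1 y.2 ^ y.1.2.2.getD y.2 0) ?_
    (Primrec.list_range.to_comp.comp (Computable.succ.comp
      (Computable.fst.comp (hC.comp Computable.fst))))
  refine pow hφ (hv.comp ((Computable.fst.comp Computable.fst).pair Computable.snd)) ?_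
  exact (Primrec.list_getD 0).to_comp.comp
    (Computable.snd.comp (Computable.snd.comp Computable.fst)) Computable.snd

/-- A bound for the total degree of the polynomial with code `c`. -/
def codeDegree (c : PolyCode) : ℕ :=
  c.2.foldr (fun t d => t.2.foldr (fun e s => e + s) 0 + d) 0

theorem computable_codeDegree : Computable codeDegree := by
  refine Primrec.to_comp (Primrec.list_foldr Primrec.snd (Primrec.const 0)
    (h := fun _ (p : (ℕ × List ℕ) × ℕ) => p.1.2.foldr (fun e s => e + s) 0 + p.2) ?_)
  refine Primrec.nat_add.comp ?_ (Primrec.snd.comp Primrec.snd)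
  refine Primrec.list_foldr (Primrec.snd.comp (Primrec.fst.comp Primrec.snd)) (Primrec.const 0)
    (h := fun _ (q : ℕ × ℕ) => q.1 + q.2) ?_
  exact Primrec.nat_add.comp (Primrec.fst.comp Primrec.snd) (Primrec.snd.comp Primrec.snd)

/-- The code's bound adds up the exponents of all terms, superfluous ones included. This is crude,
but it only has to be computable and large enough to choose a test grid. -/
theorem totalDegree_polyOfCode_le (c : PolyCode) :
    (polyOfCode φ c).2.totalDegree ≤ codeDegree c := by
  obtain ⟨k, L⟩ := c
  have hfold : ∀ l : List ℕ, l.foldr (fun e s => e + s) 0 = l.sum := fun l => rfl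
  have hsum : ∀ (n : ℕ) (l : List ℕ), ∑ i : Fin n, l.getD (i : ℕ) 0 ≤ l.sum := by
    intro n l
    induction l generalizing n with
    | nil => simp
    | cons a l ih =>
      cases n with
      | zero => simp
      | succ n =>
        rw [Fin.sum_univ_succ]
        simpa using ih n
  simp only [polyOfCode, codeDegree, hfold]
  induction L with
  | nil => simp
  | cons t L ih =>
    simp only [List.map_cons, List.sum_cons, List.foldr_cons]
    refine (MvPolynomial.totalDegree_add _ _).trans (max_le ?_ (ih.trans (Nat.le_add_left _ _)))
    refine le_trans ?_ (Nat.le_add_right _ _)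
    refine (MvPolynomial.totalDegree_monomial_le _ _).trans ?_
    rw [Finsupp.sum_fintype _ _ (by simp)]
    simpa using hsum (k + 1) t.2

end RamseyComplexity

/-! ### Testing polynomial identities on finite grids -/

namespace MvPolynomial

variable {R : Type*} [CommRing R] {n : ℕ}

/-- The degree in each single variable is at most the total degree, so the grid is longer than it in
every direction. -/
theorem eq_zero_of_eval_zero_of_totalDegree_lt_card [IsDomain R] (p : MvPolynomial (Fin n) R)
    (S : Finset R) (hS : p.totalDegree < S.card)
    (h : ∀ x : Fin n → R, (∀ i, x i ∈ S) → eval x p = 0) : p = 0 :=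
  p.eq_zero_of_eval_zero_at_prod_finset (fun _ => S)
    (fun i => (degreeOf_le_totalDegree p i).trans_lt hS) h

theorem IsHomogeneous.eval_mul_left {p : MvPolynomial (Fin n) R} {d : ℕ} (hp : p.IsHomogeneous d)
    (t : R) (x : Fin n → R) : eval (fun i => t * x i) p = t ^ d * eval x p := by
  rw [eval_eq', eval_eq', Finset.mul_sum]
  refine Finset.sum_congr rfl fun m hm => ?_
  have hd : ∑ i, m i = d := by
    rw [hp.degree_eq_sum_deg_support hm]
    exact (Finset.sum_subset (Finset.subset_univ _) (by simp)).symm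
  simp only [mul_pow, Finset.prod_mul_distrib, Finset.prod_pow_eq_pow_sum, hd]
  ring

theorem totalDegree_aeval_X_add_C_le (p : MvPolynomial (Fin n) R) (r : R) :
    (aeval (fun i => X i + C r) p : MvPolynomial (Fin n) R).totalDegree ≤ p.totalDegree := by
  rw [aeval_def, eval₂_eq']
  refine totalDegree_finsetSum_le fun m hm => ?_
  refine (totalDegree_mul _ _).trans ?_
  rw [algebraMap_eq, totalDegree_C, zero_add]
  refine (totalDegree_finsetProd _ _).trans ?_
  refine le_trans (Finset.sum_le_sum (g := fun i => m i) fun i _ => ?_) ?_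
  · refine (totalDegree_pow _ _).trans (Nat.le_trans (Nat.mul_le_mul_left _ ?_) (mul_one _).le)
    rcases subsingleton_or_nontrivial R with hR | hR
    · rw [Subsingleton.elim (X i + C r : MvPolynomial (Fin n) R) 0, totalDegree_zero]
      exact zero_le_one
    · exact (totalDegree_add _ _).trans (by simp)
  · rw [← Finsupp.sum_fintype m (fun _ e => e) (by simp)]
    exact le_totalDegree hm

theorem eval_aeval_X_add_C (p : MvPolynomial (Fin n) R) (r : R) (x : Fin n → R) :
    eval x (aeval (fun i => X i + C r) p) = eval (fun i => x i + r) p := by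
  have : (eval x).comp (aeval (R := R) (fun i : Fin n => (X i + C r : MvPolynomial (Fin n) R))).toRingHom
      = eval (fun i => x i + r) := by
    ext <;> simp
  exact RingHom.congr_fun this p

/-- For a fixed shift, the difference has total degree at most that of `p`, so grid points `x`
suffice. For a fixed `x`, it is a polynomial in the shift of no larger degree, so shifts in `S`
control all shifts. -/
theorem forall_aeval_X_add_C_eq_iff [IsDomain R] (p : MvPolynomial (Fin n) R) (S : Finset R)
    (hS : p.totalDegree < S.card) :
    (∀ r : R, aeval (fun i => X i + C r) p = p) ↔
      ∀ x : Fin n → R, (∀ i, x i ∈ S) → ∀ r ∈ S, eval (fun i => x i + r) p = eval x p := by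
  constructor
  · intro h x _ r _
    rw [← eval_aeval_X_add_C, h]
  · intro h r
    rw [← sub_eq_zero]
    refine eq_zero_of_eval_zero_of_totalDegree_lt_card _ S ?_ fun x hx => ?_
    · exact (totalDegree_sub _ _).trans_lt (max_lt ((totalDegree_aeval_X_add_C_le p r).trans_lt hS) hS)
    rw [map_sub, eval_aeval_X_add_C]
    let q : Polynomial R :=
      aeval (fun i => Polynomial.C (x i) + Polynomial.X) p - Polynomial.C (eval x p)
    have hq : ∀ s : R, q.eval s = eval (fun i => x i + s) p - eval x p := by
      intro s
      have : (Polynomial.evalRingHom s).comp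
          (aeval (R := R) (fun i : Fin n => Polynomial.C (x i) + Polynomial.X)).toRingHom
          = eval (fun i => x i + s) := by
        ext <;> simp
      have := RingHom.congr_fun this p
      simp only [q, Polynomial.eval_sub, Polynomial.eval_C]
      exact congrArg (· - _) this
    have hdeg : q.natDegree ≤ p.totalDegree := by
      refine (Polynomial.natDegree_sub_le _ _).trans (max_le ?_ (by simp))
      refine (aeval_natDegree_le p le_rfl _ (n := 1) fun i => ?_).trans_eq (mul_one _)
      exact (Polynomial.natDegree_add_le _ _).trans (by simp)
    have hq0 : q = 0 := Polynomial.eq_zero_of_natDegree_lt_card_of_eval_eq_zero' q S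
      (fun s hs => by rw [hq, h x hx s hs, sub_self]) (hdeg.trans_lt hS)
    rw [← hq, hq0, Polynomial.eval_zero]

/-- For fixed `x`, the polynomial `p(tx) - t ^ d p(x)` in `t` has more zeros than its degree allows,
so it vanishes. Its coefficient at `t ^ j` with `j ≠ d` is the value at `x` of the `j`-th
homogeneous component, which is therefore zero on the grid. -/
theorem isHomogeneous_iff_eval [IsDomain R] (p : MvPolynomial (Fin n) R) (d : ℕ) (S : Finset R)
    (hS : p.totalDegree < S.card) (hd : d < S.card) :
    p.IsHomogeneous d ↔ ∀ x : Fin n → R, (∀ i, x i ∈ S) → ∀ t ∈ S,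
      eval (fun i => t * x i) p = t ^ d * eval x p := by
  constructor
  · intro h x _ t _
    exact h.eval_mul_left t x
  · intro h
    have key : ∀ j ≤ p.totalDegree, j ≠ d → homogeneousComponent j p = 0 := by
      intro j hj hjd
      have hjc := homogeneousComponent_isHomogeneous j p
      refine eq_zero_of_eval_zero_of_totalDegree_lt_card _ S
        ((hjc.totalDegree_le.trans hj).trans_lt hS) fun x hx => ?_
      let q : Polynomial R := (∑ i ∈ Finset.range (p.totalDegree + 1),
        Polynomial.monomial i (eval x (homogeneousComponent i p))) -
          Polynomial.monomial d (eval x p)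
      have hq : ∀ t, q.eval t = eval (fun i => t * x i) p - t ^ d * eval x p := by
        intro t
        simp only [q, Polynomial.eval_sub, Polynomial.eval_finsetSum, Polynomial.eval_monomial]
        -- This expands both occurrences of `p`; the one multiplied by `t ^ d` is folded back on the
        -- next line.
        conv_rhs => rw [← sum_homogeneousComponent p]
        rw [map_sum, sum_homogeneousComponent p]
        congr 1
        · refine Finset.sum_congr rfl fun i _ => ?_
          rw [(homogeneousComponent_isHomogeneous i p).eval_mul_left, mul_comm]
        · rw [mul_comm]
      have hdeg : q.natDegree ≤ max p.totalDegree d := by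
        refine (Polynomial.natDegree_sub_le _ _).trans
          (max_le_max ?_ (Polynomial.natDegree_monomial_le _))
        refine Polynomial.natDegree_sum_le_of_forall_le _ _ fun i hi => ?_
        exact (Polynomial.natDegree_monomial_le _).trans (Nat.lt_succ_iff.1 (Finset.mem_range.1 hi))
      have hq0 : q = 0 := Polynomial.eq_zero_of_natDegree_lt_card_of_eval_eq_zero' q S
        (fun s hs => by rw [hq, h x hx s hs, sub_self]) (hdeg.trans_lt (max_lt hS hd))
      have hcoeff := congrArg (fun f => Polynomial.coeff f j) hq0
      simpa [q, Polynomial.coeff_monomial, hjd.symm, Nat.lt_succ_iff, hj] using hcoeff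
    rw [← sum_homogeneousComponent p]
    refine IsHomogeneous.sum _ _ _ fun i hi => ?_
    by_cases hid : i = d
    · exact hid ▸ homogeneousComponent_isHomogeneous i p
    · rw [key i (Nat.lt_succ_iff.1 (Finset.mem_range.1 hi)) hid]
      exact isHomogeneous_zero _ _ _

end MvPolynomial

namespace RamseyComplexity

open Filter Topology

variable {S : Type*}

/-! ### Existence of Følner sequences -/

open Classical in
/-- In a commutative cancellative monoid every finite list of elements has almost invariant finite
sets. -/
theorem exists_almost_invariant [CommMonoid S] [IsCancelMul S] {n : ℕ} (s : Fin n → S) {ε : ℝ}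
    (hε : 0 < ε) : ∃ F : Finset S, F.Nonempty ∧
      ∀ i, (((F.image (fun x => s i * x)) ∆ F).card : ℝ) ≤ ε * F.card := by
  -- Monomials in the `s i` with all exponents at most `M`: their number grows at most polynomially
  -- in `M`.
  let G : ℕ → Finset S := fun M =>
    (Fintype.piFinset fun _ : Fin n => Finset.range (M + 1)).image fun e => ∏ i, s i ^ e i
  have hmem : ∀ M x, x ∈ G M ↔ ∃ e : Fin n → ℕ, (∀ i, e i ≤ M) ∧ ∏ i, s i ^ e i = x := by
    intro M x
    simp [G]
  have hcard : ∀ M, (G M).card ≤ (M + 1) ^ n := by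
    intro M
    refine Finset.card_image_le.trans ?_
    simp
  have hne : ∀ M, (G M).Nonempty := fun M => ⟨1, (hmem M 1).2 ⟨0, by simp, by simp⟩⟩
  have hmono : ∀ M, G M ⊆ G (M + 1) := by
    intro M x hx
    obtain ⟨e, he, rfl⟩ := (hmem M x).1 hx
    exact (hmem _ _).2 ⟨e, fun i => (he i).trans (Nat.le_succ M), rfl⟩
  have himg : ∀ M i, (G M).image (fun x => s i * x) ⊆ G (M + 1) := by
    intro M i x hx
    obtain ⟨y, hy, rfl⟩ := Finset.mem_image.1 hx
    obtain ⟨e, he, rfl⟩ := (hmem M y).1 hy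
    refine (hmem _ _).2 ⟨e + Pi.single i 1, fun j => ?_, ?_⟩
    · have := he j
      by_cases hj : j = i
      · subst hj; simp; omega
      · simp [hj]; omega
    · simp only [Pi.add_apply, pow_add, Finset.prod_mul_distrib]
      rw [mul_comm]
      congr 1
      rw [Finset.prod_eq_single i] <;> simp +contextual
  -- Growth by a factor above `1 + ε / 2` at every step would be exponential, contradicting the
  -- polynomial bound.
  have hgrow : ∃ M, ((G (M + 1)).card : ℝ) ≤ (1 + ε / 2) * (G M).card := by
    by_contra! hcon
    have hlow : ∀ M, (1 + ε / 2) ^ M ≤ ((G M).card : ℝ) := by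
      intro M
      induction M with
      | zero => simpa using (hne 0).card_pos
      | succ M ih =>
        rw [pow_succ']
        exact (mul_le_mul_of_nonneg_left ih (by positivity)).trans (hcon M).le
    have h1 : Tendsto (fun M : ℕ => (M : ℝ) ^ n / (1 + ε / 2) ^ M) atTop (𝓝 0) :=
      tendsto_pow_const_div_const_pow_of_one_lt n (by linarith)
    have h2 := (tendsto_add_atTop_iff_nat 1).2 h1
    -- The threshold absorbs the extra factor in the exponent `M + 1`, leaving `(M + 1) ^ n < (1 + ε
    -- / 2) ^ M`.
    have h3 : ∀ᶠ M : ℕ in atTop,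
        ((M + 1 : ℕ) : ℝ) ^ n / (1 + ε / 2) ^ (M + 1) < 1 / (1 + ε / 2) :=
      h2.eventually_lt_const (by positivity)
    obtain ⟨M, hM⟩ := h3.exists
    have hpos : (0 : ℝ) < (1 + ε / 2) ^ M := by positivity
    have hc : ((G M).card : ℝ) ≤ ((M + 1 : ℕ) : ℝ) ^ n := by exact_mod_cast hcard M
    have := (hlow M).trans hc
    rw [pow_succ, div_lt_div_iff₀ (by positivity) (by positivity)] at hM
    nlinarith
  obtain ⟨M, hM⟩ := hgrow
  refine ⟨G M, hne M, fun i => ?_⟩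
  have hinj : Function.Injective fun x => s i * x := mul_right_injective (s i)
  -- `G M` and its translate both lie in `G (M + 1)` and, by cancellation, have the same size. Each
  -- misses at most `ε / 2 * |G M|` points, hence the half in the growth rate.
  have hsub : ((G M).image (fun x => s i * x)) ∆ (G M) ⊆
      (G (M + 1) \ (G M).image (fun x => s i * x)) ∪ (G (M + 1) \ G M) := by
    intro x hx
    rw [Finset.mem_symmDiff] at hx
    simp only [Finset.mem_union, Finset.mem_sdiff]
    rcases hx with ⟨h1, h2⟩ | ⟨h1, h2⟩
    · exact Or.inr ⟨himg M i h1, h2⟩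
    · exact Or.inl ⟨hmono M h1, h2⟩
  have hle := (Finset.card_le_card hsub).trans (Finset.card_union_le _ _)
  rw [Finset.card_sdiff_of_subset (himg M i), Finset.card_sdiff_of_subset (hmono M),
    Finset.card_image_of_injective _ hinj] at hle
  have hcc := Finset.card_le_card (hmono M)
  have : ((((G M).image (fun x => s i * x)) ∆ (G M)).card : ℝ) ≤
      2 * ((G (M + 1)).card - (G M).card) := by
    have h4 := (Nat.cast_le (α := ℝ)).2 hle
    push_cast [Nat.cast_sub hcc] at h4
    linarith
  linarith

/-- Enumerate `S` and take the `n`-th set almost invariant, up to `1 / (n + 1)`, under the first `n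
+ 1` elements. -/
theorem exists_isLeftFolner [CommMonoid S] [IsCancelMul S] [Countable S] :
    ∃ F : ℕ → Finset S, IsLeftFolner F := by
  classical
  have : Nonempty S := ⟨1⟩
  obtain ⟨s, hs⟩ := exists_surjective_nat S
  choose F hne hF using fun n : ℕ => exists_almost_invariant (fun i : Fin (n + 1) => s i)
    (ε := 1 / ((n : ℝ) + 1)) (by positivity)
  refine ⟨F, hne, fun x => ?_⟩
  obtain ⟨k, rfl⟩ := hs x
  refine squeeze_zero' (Eventually.of_forall fun n => by positivity) ?_
    tendsto_one_div_add_atTop_nhds_zero_nat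
  filter_upwards [eventually_ge_atTop k] with n hn
  have hpos : (0 : ℝ) < (F n).card := by exact_mod_cast (hne n).card_pos
  rw [div_le_iff₀ hpos]
  convert hF n ⟨k, by omega⟩ using 3

/-! ### Upper densities -/

theorem density_term_nonneg (F : ℕ → Finset S) (A : Set S) [DecidablePred (· ∈ A)] (n : ℕ) :
    (0 : ℝ) ≤ (((F n).filter (fun x => x ∈ A)).card : ℝ) / ((F n).card : ℝ) := by
  positivity

theorem density_term_le_one (F : ℕ → Finset S) (A : Set S) [DecidablePred (· ∈ A)] (n : ℕ) :
    (((F n).filter (fun x => x ∈ A)).card : ℝ) / ((F n).card : ℝ) ≤ 1 :=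
  div_le_one_of_le₀ (by exact_mod_cast Finset.card_filter_le _ _) (by positivity)

theorem upperDensity_le_one (F : ℕ → Finset S) (A : Set S) : upperDensity F A ≤ 1 := by
  classical
  exact limsup_le_of_le (isCoboundedUnder_le_of_le _ fun n => density_term_nonneg F A n)
    (Eventually.of_forall fun n => density_term_le_one F A n)

theorem upperDensity_le_upperBanachDensity [Semigroup S] {F : ℕ → Finset S} (hF : IsLeftFolner F)
    (A : Set S) : upperDensity F A ≤ upperBanachDensity A :=
  le_csSup ⟨1, by rintro _ ⟨F, -, rfl⟩; exact upperDensity_le_one F A⟩ ⟨F, hF, rfl⟩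

open Classical in
/-- If every translate of a finite list `f` has at most `c` entries in `A`, then the upper density
of `A` along any Følner sequence is at most `c / |f|`. -/
theorem upperDensity_le_of_forall_translate [CommMonoid S] [IsCancelMul S] {F : ℕ → Finset S}
    (hF : IsLeftFolner F) (A : Set S) {n : ℕ} (hn : 0 < n) (f : Fin n → S) {c : ℝ}
    (hc : ∀ s, ((Finset.univ.filter fun i => s * f i ∈ A).card : ℝ) ≤ c) :
    upperDensity F A ≤ c / n := by
  have hn' : (0 : ℝ) < n := by exact_mod_cast hn
  have hlim : Tendsto (fun m => c / n + (∑ i, ((((F m).image (fun x => f i * x)) ∆ (F m)).card : ℝ) /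
      ((F m).card : ℝ)) / n) atTop (𝓝 (c / n)) := by
    have h := (tendsto_finsetSum Finset.univ fun i _ => hF.2 (f i)).div_const (n : ℝ)
    simpa using h.const_add (c / n)
  have hterm : ∀ m, (((F m).filter (fun x => x ∈ A)).card : ℝ) / ((F m).card : ℝ) ≤
      c / n + (∑ i, ((((F m).image (fun x => f i * x)) ∆ (F m)).card : ℝ) /
      ((F m).card : ℝ)) / n := by
    intro m
    have hpos : (0 : ℝ) < (F m).card := by exact_mod_cast (hF.1 m).card_pos
    -- Replacing `x` by `f i * x` changes the count by at most the Følner error of `f i`.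
    have h1 : ∀ i, (((F m).filter (fun x => x ∈ A)).card : ℝ) ≤
        ((F m).filter (fun x => x * f i ∈ A)).card +
          ((((F m).image (fun x => f i * x)) ∆ (F m)).card : ℝ) := by
      intro i
      have hsub : (F m).filter (fun x => x ∈ A) ⊆
          ((F m).filter (fun x => x * f i ∈ A)).image (fun x => f i * x) ∪
            ((F m).image (fun x => f i * x)) ∆ (F m) := by
        intro x hx
        obtain ⟨hx1, hx2⟩ := Finset.mem_filter.1 hx
        rw [Finset.mem_union, Finset.mem_symmDiff]
        by_cases h : x ∈ (F m).image (fun x => f i * x)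
        · left
          obtain ⟨y, hy, rfl⟩ := Finset.mem_image.1 h
          exact Finset.mem_image.2 ⟨y, Finset.mem_filter.2 ⟨hy, by rwa [mul_comm]⟩, rfl⟩
        · exact Or.inr (Or.inr ⟨hx1, h⟩)
      have := (Finset.card_le_card hsub).trans (Finset.card_union_le _ _)
      exact_mod_cast this.trans (Nat.add_le_add_right Finset.card_image_le _)
    -- Double counting: exchange the sums over `i` and `x`, then apply the bound for the translate
    -- by each `x`.
    have h2 : (∑ i, (((F m).filter (fun x => x * f i ∈ A)).card : ℝ)) ≤ c * (F m).card := by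
      have : (∑ i, (((F m).filter (fun x => x * f i ∈ A)).card : ℝ)) =
          ∑ x ∈ F m, ((Finset.univ.filter fun i => x * f i ∈ A).card : ℝ) := by
        simp only [Finset.card_filter, Nat.cast_sum]
        exact Finset.sum_comm
      rw [this, mul_comm, ← nsmul_eq_mul]
      exact Finset.sum_le_card_nsmul _ _ _ fun x _ => hc x
    have h3 : n * (((F m).filter (fun x => x ∈ A)).card : ℝ) ≤ c * (F m).card +
        ∑ i, ((((F m).image (fun x => f i * x)) ∆ (F m)).card : ℝ) := by
      have h := Finset.sum_le_sum fun i (_ : i ∈ Finset.univ) => h1 i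
      rw [Finset.sum_add_distrib, Finset.sum_const, Finset.card_univ, Fintype.card_fin,
        nsmul_eq_mul] at h
      linarith
    rw [← Finset.sum_div, div_div, mul_comm ((F m).card : ℝ), ← div_div, div_le_iff₀ hpos,
      add_mul, div_mul_cancel₀ _ hpos.ne', div_mul_eq_mul_div, ← add_div, le_div_iff₀ hn']
    linarith
  refine (limsup_le_limsup (Eventually.of_forall hterm)
    (isCoboundedUnder_le_of_le _ fun n => density_term_nonneg F A n)
    hlim.isBoundedUnder_le).trans_eq hlim.limsup_eq

open Classical in
-- The counts take finitely many values, so their maximum is attained. If it were below `δ * n`, it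
-- would bound the density along every Følner sequence strictly below `δ`; attainment is what
-- permits the non-strict hypothesis.
theorem exists_translate_of_le_upperBanachDensity [CommMonoid S] [IsCancelMul S] {A : Set S}
    {δ : ℝ} (hA : δ ≤ upperBanachDensity A) {n : ℕ} (f : Fin n → S) :
    ∃ s, δ * n ≤ ((Finset.univ.filter fun i => s * f i ∈ A).card : ℝ) := by
  rcases Nat.eq_zero_or_pos n with rfl | hn
  · exact ⟨1, by simp⟩
  have hn' : (0 : ℝ) < n := by exact_mod_cast hn
  by_contra! hcon
  let T : Set ℕ := Set.range fun s => (Finset.univ.filter fun i => s * f i ∈ A).card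
  have hTfin : T.Finite := (Set.finite_Iic n).subset (by
    rintro _ ⟨s, rfl⟩
    simpa using Finset.card_filter_le Finset.univ fun i => s * f i ∈ A)
  obtain ⟨_, ⟨s, rfl⟩, hs⟩ := hTfin.exists_maximalFor id T ⟨_, 1, rfl⟩
  have hmax : ∀ t, (Finset.univ.filter fun i => t * f i ∈ A).card ≤
      (Finset.univ.filter fun i => s * f i ∈ A).card := by
    intro t
    by_contra! hlt
    exact absurd (hs ⟨t, rfl⟩ hlt.le) (not_le.2 hlt)
  have hle : upperBanachDensity A ≤
      ((Finset.univ.filter fun i => s * f i ∈ A).card : ℝ) / n := by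
    refine Real.sSup_le ?_ (by positivity)
    rintro _ ⟨F, hF, rfl⟩
    exact upperDensity_le_of_forall_translate hF A hn f fun t => by exact_mod_cast hmax t
  have := hcon s
  rw [← div_lt_iff₀ hn'] at this
  linarith

end RamseyComplexity

namespace RamseyComplexity

open Filter Topology MeasureTheory

variable {S : Type*}

/-! ### A compactness principle for density -/

open Classical in
/-- If `μ` gives mass at least `δ` to each of the events `s ∈ B`, then, outside any null set, some
point `B` has upper density at least `δ` along `F`. -/
theorem exists_le_upperDensity_of_measure [Countable S] {F : ℕ → Finset S}
    (hF : ∀ n, (F n).Nonempty) {δ : ℝ} (μ : Measure (S → Bool)) [IsProbabilityMeasure μ]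
    (hμ : ∀ s, ENNReal.ofReal δ ≤ μ {ω | ω s = true}) {N : Set (S → Bool)} (hN : μ N = 0) :
    ∃ ω, ω ∉ N ∧ δ ≤ upperDensity F {s | ω s = true} := by
  obtain ⟨T, hT⟩ : ∃ T : (S → Bool) → Set S, T = fun ω => {s | ω s = true} := ⟨_, rfl⟩
  suffices ∃ ω, ω ∉ N ∧ δ ≤ upperDensity F (T ω) by simpa only [hT] using this
  let a : ℕ → (S → Bool) → ENNReal := fun n ω =>
    (∑ s ∈ F n, ({ω : S → Bool | ω s = true}.indicator 1 ω)) / (F n).card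
  have hmeasA : ∀ s : S, MeasurableSet {ω : S → Bool | ω s = true} := fun s =>
    measurable_pi_apply (X := fun _ : S => Bool) s (measurableSet_singleton true)
  have hsum : ∀ n, Measurable fun ω : S → Bool =>
      ∑ s ∈ F n, ({ω : S → Bool | ω s = true}.indicator (1 : (S → Bool) → ENNReal) ω) := fun n =>
    Finset.measurable_fun_sum _ fun s _ => measurable_one.indicator (hmeasA s)
  have hmeas : ∀ n, Measurable (a n) := fun n => (hsum n).div_const _
  have hcard0 : ∀ n, ((F n).card : ENNReal) ≠ 0 := fun n => by
    exact_mod_cast (hF n).card_pos.ne'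
  have ha : ∀ n ω, a n ω = ENNReal.ofReal
      ((((F n).filter (fun x => x ∈ T ω)).card : ℝ) / ((F n).card : ℝ)) := by
    intro n ω
    rw [ENNReal.ofReal_div_of_pos (by exact_mod_cast (hF n).card_pos), ENNReal.ofReal_natCast,
      ENNReal.ofReal_natCast]
    simp only [a]
    congr 1
    rw [Finset.card_filter]
    push_cast
    exact Finset.sum_congr rfl fun s _ => by simp [Set.indicator_apply, hT]
  have hbound : ∀ n ω, a n ω ≤ 1 := fun n ω => by
    rw [ha, ← ENNReal.ofReal_one]
    exact ENNReal.ofReal_le_ofReal (density_term_le_one F _ n)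
  -- By linearity, the mean of the relative density on `F n` is at least `δ`.
  have hint : ∀ n, ENNReal.ofReal δ ≤ ∫⁻ ω, a n ω ∂μ := by
    intro n
    simp only [a, div_eq_mul_inv]
    rw [lintegral_mul_const _ (hsum n), lintegral_finsetSum _
      fun s _ => measurable_one.indicator (hmeasA s), ← div_eq_mul_inv,
      ENNReal.le_div_iff_mul_le (Or.inl (hcard0 n)) (Or.inl (ENNReal.natCast_ne_top _)),
      mul_comm, ← nsmul_eq_mul]
    refine Finset.card_nsmul_le_sum _ _ _ fun s _ => ?_
    rw [lintegral_indicator_one (hmeasA s)]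
    exact hμ s
  -- Reverse Fatou, with the constant `1` as dominating function.
  have hfatou := limsup_lintegral_le (μ := μ) (f := a) (fun _ => 1) hmeas
    (fun n => Eventually.of_forall (hbound n)) (by simp)
  have hδ : ENNReal.ofReal δ ≤ ∫⁻ ω, limsup (fun n => a n ω) atTop ∂μ :=
    (le_limsup_of_le (by isBoundedDefault) fun b hb =>
      let ⟨n, hn⟩ := hb.exists; (hint n).trans hn).trans hfatou
  have hfin : ∫⁻ ω, limsup (fun n => a n ω) atTop ∂μ ≠ ⊤ := by
    refine ne_top_of_le_ne_top ENNReal.one_ne_top ?_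
    refine (lintegral_mono (g := fun _ => 1) fun ω => ?_).trans (by simp)
    exact limsup_le_of_le (by isBoundedDefault) (Eventually.of_forall fun n => hbound n ω)
  obtain ⟨ω, hω, hle⟩ := exists_notMem_null_lintegral_le hfin hN
  -- What remains is the passage from the `ENNReal`-valued upper limit to the real one, through an
  -- intermediate `b' < δ`.
  refine ⟨ω, hω, le_of_forall_lt fun b hb => ?_⟩
  obtain ⟨b', hb', hb'δ⟩ := exists_between hb
  refine hb'.trans_le ?_
  refine le_limsup_of_frequently_le ?_
    (isBoundedUnder_of ⟨1, fun n => density_term_le_one F (T ω) n⟩)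
  by_contra hcon
  rw [not_frequently] at hcon
  have h0 : 0 < b' := by
    obtain ⟨n, hn⟩ := hcon.exists
    exact (density_term_nonneg F _ n).trans_lt (not_le.1 hn)
  have hlim : limsup (fun n => a n ω) atTop ≤ ENNReal.ofReal b' := by
    refine limsup_le_of_le (by isBoundedDefault) (hcon.mono fun n hn => ?_)
    rw [ha]
    exact ENNReal.ofReal_le_ofReal (not_le.1 hn).le
  have := (hδ.trans hle).trans hlim
  rw [ENNReal.ofReal_le_ofReal_iff h0.le] at this
  linarith

open Classical in
/-- If every finite set `F` contains an `E`-free set of relative density at least `δ`, then some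
`E`-free set has upper Banach density at least `δ`. -/
theorem exists_free_of_finite_free [CommMonoid S] [IsCancelMul S] [Countable S] {ι : Type*}
    [Finite ι] {E : Set (ι → S)} (hE : ∀ e ∈ E, ∀ s : S, (fun i => s * e i) ∈ E) {δ : ℝ}
    (h : ∀ F : Finset S, ∃ B ⊆ F, δ * F.card ≤ B.card ∧ ∀ e ∈ E, ¬ ∀ i, e i ∈ B) :
    ∃ A : Set S, δ ≤ upperBanachDensity A ∧ ∀ e ∈ E, ¬ ∀ i, e i ∈ A := by
  obtain ⟨F, hF⟩ := exists_isLeftFolner (S := S)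
  choose B hBF hBcard hBE using fun n => h (F n)
  let _ : MeasurableSpace S := ⊤
  -- The translate `{s | x * s ∈ B n}` as a point of the Cantor space; `x` will be uniform in `F n`.
  let g : ℕ → S → S → Bool := fun n x s => decide (x * s ∈ B n)
  have hg : ∀ n, Measurable (g n) := fun n => measurable_from_top
  let ν : ℕ → Measure S := fun n => (PMF.uniformOfFinset (F n) (hF.1 n)).toMeasure
  let μ : ℕ → ProbabilityMeasure (S → Bool) := fun n =>
    ⟨(ν n).map (g n), Measure.isProbabilityMeasure_map (hg n).aemeasurable⟩
  have hμ : ∀ n (A : Set (S → Bool)), MeasurableSet A → (μ n : Measure (S → Bool)) A =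
      (((F n).filter fun x => g n x ∈ A).card : ENNReal) / (F n).card := by
    intro n A hA
    change (ν n).map (g n) A = _
    rw [Measure.map_apply (hg n) hA]
    exact (PMF.toMeasure_uniformOfFinset_apply _ _ MeasurableSpace.measurableSet_top).trans (by simp)
  let U : Ultrafilter ℕ := hyperfilter ℕ
  have hU : (U : Filter ℕ) ≤ atTop := Nat.hyperfilter_le_atTop
  -- The space of probability measures on the compact space `S → Bool` is compact.
  obtain ⟨m, -, hm⟩ := isCompact_univ.ultrafilter_le_nhds (U.map μ) (by simp)
  have hlim : Tendsto μ U (𝓝 m) := hm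
  -- Clopen sets have empty frontier, so weak convergence gives convergence of their masses.
  have hclopen : ∀ A : Set (S → Bool), IsClopen A →
      Tendsto (fun n => (μ n : Measure (S → Bool)) A) U (𝓝 ((m : Measure (S → Bool)) A)) :=
    fun A hA => ProbabilityMeasure.tendsto_measure_of_null_frontier_of_tendsto' hlim
      (by simp [hA.frontier_eq])
  have hcoord : ∀ s : S, IsClopen {ω : S → Bool | ω s = true} := fun s =>
    (isClopen_discrete {true}).preimage (continuous_apply s)
  -- At stage `n` the event has probability at least `δ` minus the Følner error of `s`, and the
  -- error vanishes in the limit.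
  have hmass : ∀ s : S, ENNReal.ofReal δ ≤ (m : Measure (S → Bool)) {ω | ω s = true} := by
    intro s
    have h0 : Tendsto (fun n => ENNReal.ofReal (δ -
        ((((F n).image (fun x => s * x)) ∆ (F n)).card : ℝ) / ((F n).card : ℝ))) U
        (𝓝 (ENNReal.ofReal δ)) := by
      have := (((hF.2 s).mono_left hU).const_sub δ)
      rw [sub_zero] at this
      exact (ENNReal.continuous_ofReal.tendsto _).comp this
    refine le_of_tendsto_of_tendsto h0 (hclopen _ (hcoord s)) (Eventually.of_forall fun n => ?_)
    have hpos : (0 : ℝ) < (F n).card := by exact_mod_cast (hF.1 n).card_pos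
    have hsub : B n ⊆ ((F n).filter fun x => x * s ∈ B n).image (fun x => s * x) ∪
        ((F n).image (fun x => s * x)) ∆ (F n) := by
      intro x hx
      rw [Finset.mem_union, Finset.mem_symmDiff]
      by_cases hxs : x ∈ (F n).image (fun x => s * x)
      · left
        obtain ⟨y, hy, rfl⟩ := Finset.mem_image.1 hxs
        exact Finset.mem_image.2 ⟨y, Finset.mem_filter.2 ⟨hy, by rwa [mul_comm]⟩, rfl⟩
      · exact Or.inr (Or.inr ⟨hBF n hx, hxs⟩)
    have hle := ((Finset.card_le_card hsub).trans (Finset.card_union_le _ _)).trans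
      (Nat.add_le_add_right Finset.card_image_le _)
    have hle' : ((B n).card : ℝ) ≤ ((F n).filter fun x => x * s ∈ B n).card +
        (((F n).image (fun x => s * x)) ∆ (F n)).card := by exact_mod_cast hle
    beta_reduce
    rw [hμ n _ (hcoord s).isOpen.measurableSet]
    have hcongr : ∀ A : Set (S → Bool), (∀ x, g n x ∈ A ↔ x * s ∈ B n) →
        ((F n).filter fun x => g n x ∈ A) = (F n).filter fun x => x * s ∈ B n :=
      fun A hA => Finset.filter_congr fun x _ => hA x
    rw [hcongr _ (by simp [g]), ← ENNReal.ofReal_natCast, ← ENNReal.ofReal_natCast (F n).card,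
      ← ENNReal.ofReal_div_of_pos hpos]
    refine ENNReal.ofReal_le_ofReal ?_
    rw [le_div_iff₀ hpos, sub_mul, div_mul_cancel₀ _ hpos.ne']
    linarith [hBcard n]
  -- At every stage the event is empty: it would put the translate `x * e`, again in `E`, inside `B
  -- n`.
  have hnull : ∀ e ∈ E, (m : Measure (S → Bool)) {ω | ∀ i, ω (e i) = true} = 0 := by
    intro e he
    have hc : IsClopen {ω : S → Bool | ∀ i, ω (e i) = true} := by
      rw [Set.ofPred_forall]
      exact isClopen_iInter_of_finite fun i => hcoord (e i)
    refine tendsto_nhds_unique (hclopen _ hc) ?_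
    refine tendsto_const_nhds.congr fun n => ?_
    rw [hμ n _ hc.isOpen.measurableSet, Finset.filter_false_of_mem, Finset.card_empty]
    · simp
    · intro x _ hx
      exact hBE n _ (hE e he x) fun i => by simpa [g] using hx i
  -- `E` is countable because `ι` is finite and `S` is countable.
  have hN : (m : Measure (S → Bool)) (⋃ e ∈ E, {ω | ∀ i, ω (e i) = true}) = 0 :=
    (measure_biUnion_null_iff E.to_countable).2 hnull
  obtain ⟨ω, hω, hd⟩ := exists_le_upperDensity_of_measure hF.1 (m : Measure (S → Bool)) hmass hN
  refine ⟨{s | ω s = true}, hd.trans (upperDensity_le_upperBanachDensity hF _), fun e he hi => ?_⟩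
  exact hω (Set.mem_biUnion he hi)

/-- A translation invariant family `E` meets every set of upper Banach density at least `δ` if and
only if, for some finite list `L`, it meets every sublist of `L` of relative length at least `δ`. -/
theorem forall_density_iff_exists_list [CommMonoid S] [IsCancelMul S] [Countable S] {ι : Type*}
    [Finite ι] {E : Set (ι → S)} (hE : ∀ e ∈ E, ∀ s : S, (fun i => s * e i) ∈ E) {δ : ℝ} :
    (∀ A : Set S, δ ≤ upperBanachDensity A → ∃ e ∈ E, ∀ i, e i ∈ A) ↔
      ∃ L : List S, ∀ B ∈ L.sublists', δ * L.length ≤ B.length → ∃ e ∈ E, ∀ i, e i ∈ B := by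
  classical
  constructor
  · intro h
    by_contra! hcon
    obtain ⟨A, hA, hAE⟩ := exists_free_of_finite_free (δ := δ) hE fun F => by
      obtain ⟨B, hB, hlen, hfree⟩ := hcon F.toList
      rw [List.mem_sublists'] at hB
      have hnd : B.Nodup := hB.nodup F.nodup_toList
      refine ⟨B.toFinset, fun x hx => ?_, ?_, fun e he hi => ?_⟩
      · exact Finset.mem_toList.1 (hB.subset (List.mem_toFinset.1 hx))
      · rw [List.toFinset_card_of_nodup hnd]
        simpa using hlen
      · obtain ⟨i, hi'⟩ := hfree e he
        exact hi' (List.mem_toFinset.1 (hi i))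
    obtain ⟨e, he, hi⟩ := h A hA
    exact hAE e he hi
  · rintro ⟨L, hL⟩ A hA
    -- Repetitions in `L` are harmless: entries are counted with multiplicity on both sides.
    obtain ⟨s, hs⟩ := exists_translate_of_le_upperBanachDensity hA L.get
    have hcount : (Finset.univ.filter fun i => s * L.get i ∈ A).card =
        (L.filter fun x => s * x ∈ A).length := by
      conv_rhs => rw [← List.map_get_finRange L, List.filter_map, List.length_map]
      rfl
    obtain ⟨e, he, hi⟩ := hL (L.filter fun x => s * x ∈ A)
      (List.mem_sublists'.2 List.filter_sublist) (by rw [← hcount]; exact hs)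
    exact ⟨_, hE e he s, fun i => by simpa using (List.mem_filter.1 (hi i)).2⟩

end RamseyComplexity

namespace RamseyComplexity

open Filter

variable {R : Type*} {φ : R ≃ ℕ}

/-! ### Points coded by lists -/

/-- The point of `R ^ ℕ` coded by a list of natural numbers. -/
def listPoint (φ : R ≃ ℕ) (l : List ℕ) (i : ℕ) : R :=
  φ.symm (l.getD i 0)

theorem listPoint_ofFn {n : ℕ} (a : Fin n → R) (i : Fin n) :
    listPoint φ (List.ofFn fun j => φ (a j)) i = a i := by
  simp [listPoint, List.getD_eq_getElem?_getD]

theorem listPoint_mem {l : List ℕ} {B : Set R} (h : ∀ n ∈ l, φ.symm n ∈ B) {i : ℕ}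
    (hi : i < l.length) : listPoint φ l i ∈ B := by
  rw [listPoint, List.getD_eq_getElem _ _ hi]
  exact h _ (List.getElem_mem hi)

theorem rComputable_listPoint {α : Type*} [Primcodable α] {L : α → List ℕ} {i : α → ℕ}
    (hL : Computable L) (hi : Computable i) :
    RComputable φ fun a => listPoint φ (L a) (i a) :=
  RComputable.symm ((Primrec.list_getD 0).to_comp.comp hL hi)

/-- Turns a test on the grid formed by the first `N` ring elements into a bounded quantifier over
words, hence a computable one. -/
theorem forall_grid_iff {n : ℕ} (N : ℕ) (P : (Fin n → R) → Prop) :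
    (∀ x : Fin n → R, (∀ i, x i ∈ (Finset.range N).map φ.symm.toEmbedding) → P x) ↔
      ∀ w ∈ (List.range N).words n, P fun i => listPoint φ w i := by
  simp only [List.mem_words, List.mem_range, Finset.mem_map_equiv, Equiv.symm_symm,
    Finset.mem_range]
  constructor
  · rintro h w ⟨rfl, hw⟩
    exact h _ fun i => listPoint_mem (B := {x | φ x < N}) (by simpa using hw) i.2
  · intro h x hx
    have := h (List.ofFn fun j => φ (x j)) ⟨by simp, by simpa [List.mem_ofFn] using hx⟩
    simpa only [listPoint_ofFn] using this

variable [CommRing R]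

/-- The list `l` codes a root of the polynomial with code `c`. -/
def IsRootCode (φ : R ≃ ℕ) (c : PolyCode) (l : List ℕ) : Prop :=
  l.length = c.1 + 1 ∧ evalCode φ c (listPoint φ l) = 0

theorem computablePred_isRootCode (hφ : IsComputablePresentation φ) :
    ComputablePred fun q : PolyCode × List ℕ => IsRootCode φ q.1 q.2 := by
  refine (ComputablePred.eq (Computable.list_length.comp Computable.snd)
    (Computable.succ.comp (Computable.fst.comp Computable.fst))).and ?_
  refine RComputable.eq (RComputable.evalCode hφ Computable.fst ?_) (RComputable.const 0)
  exact rComputable_listPoint (Computable.snd.comp Computable.fst) Computable.snd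

theorem containsRoot_iff (c : PolyCode) (B : Set R) :
    ContainsRoot (polyOfCode φ c) B ↔ ∃ l, IsRootCode φ c l ∧ ∀ n ∈ l, φ.symm n ∈ B := by
  change (∃ a : Fin (c.1 + 1) → R, (∀ i, a i ∈ B) ∧
    MvPolynomial.eval a (polyOfCode φ c).2 = 0) ↔ _
  constructor
  · rintro ⟨a, haB, ha⟩
    refine ⟨List.ofFn fun j => φ (a j), ⟨List.length_ofFn, ?_⟩, ?_⟩
    · rw [← eval_polyOfCode]
      simpa only [listPoint_ofFn] using ha
    · exact List.forall_mem_ofFn_iff.2 fun i => by simpa using haB i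
  · rintro ⟨l, ⟨hlen, hl⟩, hB⟩
    refine ⟨fun i => listPoint φ l i, fun i => listPoint_mem hB (i.2.trans_eq hlen.symm), ?_⟩
    rw [← eval_polyOfCode] at hl
    exact hl

theorem containsInjectiveRoot_iff (c : PolyCode) (B : Set R) :
    ContainsInjectiveRoot (polyOfCode φ c) B ↔
      ∃ l, (IsRootCode φ c l ∧ l.Nodup) ∧ ∀ n ∈ l, φ.symm n ∈ B := by
  change (∃ a : Fin (c.1 + 1) → R, Function.Injective a ∧ (∀ i, a i ∈ B) ∧
    MvPolynomial.eval a (polyOfCode φ c).2 = 0) ↔ _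
  constructor
  · rintro ⟨a, hinj, haB, ha⟩
    refine ⟨List.ofFn fun j => φ (a j), ⟨⟨List.length_ofFn, ?_⟩, ?_⟩, ?_⟩
    · rw [← eval_polyOfCode]
      simpa only [listPoint_ofFn] using ha
    · exact List.nodup_ofFn.2 (φ.injective.comp hinj)
    · exact List.forall_mem_ofFn_iff.2 fun i => by simpa using haB i
  · rintro ⟨l, ⟨⟨hlen, hl⟩, hnd⟩, hB⟩
    refine ⟨fun i => listPoint φ l i, fun i j hij => ?_,
      fun i => listPoint_mem hB (i.2.trans_eq hlen.symm), ?_⟩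
    · have hi : (i : ℕ) < l.length := i.2.trans_eq hlen.symm
      have hj : (j : ℕ) < l.length := j.2.trans_eq hlen.symm
      have h := φ.symm.injective hij
      rw [List.getD_eq_getElem _ _ hi, List.getD_eq_getElem _ _ hj] at h
      exact Fin.ext ((hnd.getElem_inj_iff).1 h)
    · rw [← eval_polyOfCode] at hl
      exact hl

/-! ### Homogeneous and translation invariant polynomials -/

theorem sigmaOne_mem_H [IsDomain R] (hφ : IsComputablePresentation φ) :
    SigmaOne fun c : PolyCode => polyOfCode φ c ∈ H R := by
  -- The side of the grid has to exceed both the total degree and the candidate degree `d`.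
  let N : PolyCode × ℕ → ℕ := fun q => codeDegree q.1 + q.2 + 1
  have hN : Computable N := Computable.succ.comp (Primrec.nat_add.to_comp.comp
    (computable_codeDegree.comp Computable.fst) Computable.snd)
  have hr : Computable fun q => List.range (N q) := Primrec.list_range.to_comp.comp hN
  have key : ComputablePred fun y : ((PolyCode × ℕ) × List ℕ) × ℕ =>
      evalCode φ y.1.1.1 (fun i => φ.symm y.2 * listPoint φ y.1.2 i) =
        φ.symm y.2 ^ y.1.1.2 * evalCode φ y.1.1.1 (listPoint φ y.1.2) := by
    have hc : Computable fun y : ((PolyCode × ℕ) × List ℕ) × ℕ => y.1.1.1 :=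
      Computable.fst.comp (Computable.fst.comp Computable.fst)
    have ht : RComputable φ fun y : ((PolyCode × ℕ) × List ℕ) × ℕ => φ.symm y.2 :=
      RComputable.symm Computable.snd
    have hp : RComputable φ fun z : (((PolyCode × ℕ) × List ℕ) × ℕ) × ℕ =>
        listPoint φ z.1.1.2 z.2 :=
      rComputable_listPoint (Computable.snd.comp (Computable.fst.comp Computable.fst))
        Computable.snd
    refine RComputable.eq (RComputable.evalCode hφ hc ?_)
      (RComputable.mul hφ (RComputable.pow hφ ht
        (Computable.snd.comp (Computable.fst.comp Computable.fst)))
        (RComputable.evalCode hφ hc hp))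
    exact RComputable.mul hφ (ht.comp Computable.fst) hp
  have h1 := key.forall_mem_list (hr.comp Computable.fst)
  have h2 := h1.forall_mem_list (L := fun q : PolyCode × ℕ => (List.range (N q)).words (q.1.1 + 1))
    (Primrec.list_words.to_comp.comp hr
      (Computable.succ.comp (Computable.fst.comp Computable.fst)))
  refine (SigmaOne.exists_nat (SigmaOne.of_computablePred h2)).of_eq fun c => exists_congr fun d => ?_
  have hcard : ((Finset.range (N (c, d))).map φ.symm.toEmbedding).card = codeDegree c + d + 1 := by
    simp [N]
  have hdeg := totalDegree_polyOfCode_le (φ := φ) c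
  rw [MvPolynomial.isHomogeneous_iff_eval _ d ((Finset.range (N (c, d))).map φ.symm.toEmbedding)
    (by omega) (by omega)]
  refine Iff.trans ?_ (forall_grid_iff (N (c, d)) _).symm
  refine forall₂_congr fun w _ => ?_
  simp only [← eval_polyOfCode, Finset.forall_mem_map, List.mem_range, Finset.mem_range]
  rfl

theorem sigmaOne_mem_T [IsDomain R] (hφ : IsComputablePresentation φ) :
    SigmaOne fun c : PolyCode => polyOfCode φ c ∈ T R := by
  let N : PolyCode → ℕ := fun c => codeDegree c + 1
  have hN : Computable N := Computable.succ.comp computable_codeDegree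
  have hr : Computable fun q => List.range (N q) := Primrec.list_range.to_comp.comp hN
  have key : ComputablePred fun y : (PolyCode × List ℕ) × ℕ =>
      evalCode φ y.1.1 (fun i => listPoint φ y.1.2 i + φ.symm y.2) =
        evalCode φ y.1.1 (listPoint φ y.1.2) := by
    have hc : Computable fun y : (PolyCode × List ℕ) × ℕ => y.1.1 :=
      Computable.fst.comp Computable.fst
    have hp : RComputable φ fun z : ((PolyCode × List ℕ) × ℕ) × ℕ => listPoint φ z.1.1.2 z.2 :=
      rComputable_listPoint (Computable.snd.comp (Computable.fst.comp Computable.fst))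
        Computable.snd
    refine RComputable.eq (RComputable.evalCode hφ hc ?_) (RComputable.evalCode hφ hc hp)
    exact RComputable.add hφ hp (RComputable.symm (Computable.snd.comp Computable.fst))
  have h1 := key.forall_mem_list (hr.comp Computable.fst)
  have h2 := h1.forall_mem_list (L := fun q : PolyCode => (List.range (N q)).words (q.1 + 1))
    (Primrec.list_words.to_comp.comp hr (Computable.succ.comp Computable.fst))
  refine (SigmaOne.of_computablePred h2).of_eq fun c => ?_
  have hcard : ((Finset.range (N c)).map φ.symm.toEmbedding).card = codeDegree c + 1 := by
    simp [N]
  have hdeg := totalDegree_polyOfCode_le (φ := φ) c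
  refine Iff.trans ?_ (MvPolynomial.forall_aeval_X_add_C_eq_iff _
    ((Finset.range (N c)).map φ.symm.toEmbedding) (by omega)).symm
  refine Iff.trans ?_ (forall_grid_iff (N c) _).symm
  refine forall₂_congr fun w _ => ?_
  simp only [← eval_polyOfCode, Finset.forall_mem_map, List.mem_range, Finset.mem_range]
  rfl

/-! ### Compactness for partitions -/

/-- Partition regularity of a family of finite lists is witnessed by a finite initial segment. -/
theorem forall_partition_iff (𝓔 : Set (List ℕ)) (ℓ : ℕ) :
    (∀ C : Fin (ℓ + 1) → Set R, IsPartitionNonzero C →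
      ∃ i, ∃ l ∈ 𝓔, ∀ n ∈ l, φ.symm n ∈ C i) ↔
    ∃ N, ∀ w ∈ (List.range (ℓ + 1)).words N, ∃ q : ℕ × List ℕ,
      q.1 < ℓ + 1 ∧ q.2 ∈ 𝓔 ∧ ∀ n ∈ q.2, φ.symm n ≠ 0 ∧ w[n]? = some q.1 := by
  classical
  constructor
  · intro h
    by_contra! hcon
    choose w hw hbad using hcon
    have hcol : ∀ N, ∃ g : ℕ → Fin (ℓ + 1), ∀ n < N, (w N)[n]? = some (g n : ℕ) := by
      intro N
      obtain ⟨hlen, hlt⟩ := List.mem_words.1 (hw N)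
      refine ⟨fun n => if hn : n < (w N).length then
        ⟨(w N)[n], List.mem_range.1 (hlt _ (List.getElem_mem hn))⟩ else 0, fun n hn => ?_⟩
      have hn' : n < (w N).length := hn.trans_eq hlen.symm
      simp [hn']
    choose g hg using hcol
    -- With finitely many colours, the colour of `n` is constant along the ultrafilter.
    have hlim : ∀ n, ∃ c : Fin (ℓ + 1), ∀ᶠ N in (hyperfilter ℕ : Filter ℕ), g N n = c := by
      intro n
      obtain ⟨c, hc⟩ := Ultrafilter.eq_pure_of_finite ((hyperfilter ℕ).map fun N => g N n)
      refine ⟨c, ?_⟩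
      have : {c} ∈ (hyperfilter ℕ).map fun N => g N n := by rw [hc]; exact Set.mem_singleton c
      exact this
    choose col hcol using hlim
    obtain ⟨i, l, hl, hmono⟩ := h (fun i => {x | x ≠ 0 ∧ col (φ x) = i})
      ⟨by ext x; simp, fun i j hij => Set.disjoint_left.2 fun x hx hx' => hij (hx.2.symm.trans hx'.2)⟩
    -- Only the finitely many entries of `l` matter, so one bad colouring agrees with the limit on
    -- all of them and has them in its domain.
    have hev : ∀ᶠ N in (hyperfilter ℕ : Filter ℕ), ∀ n ∈ l.toFinset, g N n = i ∧ n < N := by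
      rw [eventually_all_finset]
      intro n hn
      have hn' := hmono n (List.mem_toFinset.1 hn)
      have hi : col n = i := by simpa using hn'.2
      filter_upwards [hcol n, Nat.hyperfilter_le_atTop (eventually_gt_atTop n)] with N h1 h2
      exact ⟨h1.trans hi, h2⟩
    obtain ⟨N, hN⟩ := hev.exists
    obtain ⟨n, hn, hne⟩ := hbad N (i, l) i.2 hl
    obtain ⟨h1, h2⟩ := hN n (List.mem_toFinset.2 hn)
    exact hne (hmono n hn).1 (by rw [hg N n h2, h1])
  · rintro ⟨N, hN⟩ C hC
    -- The default colour is used only for the code of `0`, which lies in no cell; the finite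
    -- condition excludes it from the roots considered.
    let col : ℕ → Fin (ℓ + 1) := fun n => if h : ∃ j, φ.symm n ∈ C j then h.choose else 0
    have hcol : ∀ n, φ.symm n ≠ 0 → φ.symm n ∈ C (col n) := by
      intro n hn
      have h : ∃ j, φ.symm n ∈ C j := by
        rw [← Set.mem_iUnion, hC.1]; exact hn
      simp only [col, dif_pos h]
      exact h.choose_spec
    obtain ⟨⟨i, l⟩, hi, hl, hmono⟩ := hN ((List.range N).map fun n => (col n : ℕ))
      (List.mem_words.2 ⟨by simp, fun a ha => by
        obtain ⟨n, -, rfl⟩ := List.mem_map.1 ha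
        exact List.mem_range.2 (col n).2⟩)
    refine ⟨⟨i, hi⟩, l, hl, fun n hn => ?_⟩
    obtain ⟨h0, h1⟩ := hmono n hn
    have : col n = ⟨i, hi⟩ := by
      simp only [List.getElem?_map, Option.map_eq_some_iff, List.getElem?_eq_some_iff,
        List.length_range, List.getElem_range] at h1
      obtain ⟨a, ⟨-, rfl⟩, h⟩ := h1
      exact Fin.ext h
    exact this ▸ hcol n h0

/-- The number of colours is an input rather than a fixed parameter, as the intersection over all
`ℓ` requires uniformity. -/
theorem sigmaOne_partition {𝓔 : PolyCode → List ℕ → Prop}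
    (h𝓔 : ComputablePred fun q : PolyCode × List ℕ => 𝓔 q.1 q.2) :
    SigmaOne fun x : ℕ × PolyCode => ∀ C : Fin (x.1 + 1) → Set R, IsPartitionNonzero C →
      ∃ i, ∃ l, 𝓔 x.2 l ∧ ∀ n ∈ l, φ.symm n ∈ C i := by
  have h0 : ComputablePred fun y : (((ℕ × PolyCode) × ℕ) × List ℕ) × ℕ × List ℕ =>
      y.2.1 < y.1.1.1.1 + 1 ∧ 𝓔 y.1.1.1.2 y.2.2 ∧
        ∀ n ∈ y.2.2, φ.symm n ≠ 0 ∧ y.1.2[n]? = some y.2.1 := by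
    have hx : Computable fun y : (((ℕ × PolyCode) × ℕ) × List ℕ) × ℕ × List ℕ => y.1.1.1 :=
      Computable.fst.comp (Computable.fst.comp Computable.fst)
    refine (ComputablePred.lt (Computable.fst.comp Computable.snd)
      (Computable.succ.comp (Computable.fst.comp hx))).and
      ((h𝓔.comp ((Computable.snd.comp hx).pair (Computable.snd.comp Computable.snd))).and ?_)
    refine ComputablePred.forall_mem_list (p := fun z :
      ((((ℕ × PolyCode) × ℕ) × List ℕ) × ℕ × List ℕ) × ℕ =>
        φ.symm z.2 ≠ 0 ∧ z.1.1.2[z.2]? = some z.1.2.1) ?_ (Computable.snd.comp Computable.snd)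
    refine (RComputable.eq (RComputable.symm Computable.snd) (RComputable.const 0)).not.and ?_
    exact ComputablePred.eq (Computable.list_getElem?.comp
      (Computable.snd.comp (Computable.fst.comp Computable.fst)) Computable.snd)
      (Computable.option_some.comp (Computable.fst.comp (Computable.snd.comp Computable.fst)))
  have h1 := (SigmaOne.of_computablePred h0).exists_codable
  have h2 := h1.forall_mem_list (L := fun x : (ℕ × PolyCode) × ℕ =>
    (List.range (x.1.1 + 1)).words x.2) (Primrec.list_words.to_comp.comp
      (Primrec.list_range.to_comp.comp (Computable.succ.comp
        (Computable.fst.comp Computable.fst))) Computable.snd)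
  exact h2.exists_nat.of_eq fun x => (forall_partition_iff {l | 𝓔 x.2 l} x.1).symm

theorem sigmaOne_PRAt (hφ : IsComputablePresentation φ) :
    SigmaOne fun x : ℕ × PolyCode => polyOfCode φ x.2 ∈ PRAt R (x.1 + 1) :=
  (sigmaOne_partition (φ := φ) (computablePred_isRootCode hφ)).of_eq fun x => by
    simp only [PRAt, Set.mem_ofPred_eq, containsRoot_iff (φ := φ)]

theorem sigmaOne_IPRAt (hφ : IsComputablePresentation φ) :
    SigmaOne fun x : ℕ × PolyCode => polyOfCode φ x.2 ∈ IPRAt R (x.1 + 1) :=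
  (sigmaOne_partition (φ := φ) (𝓔 := fun c l => IsRootCode φ c l ∧ l.Nodup)
    ((computablePred_isRootCode hφ).and (ComputablePred.nodup Computable.snd))).of_eq fun x => by
    simp only [IPRAt, Set.mem_ofPred_eq, containsInjectiveRoot_iff (φ := φ)]

end RamseyComplexity

namespace RamseyComplexity

variable {R : Type*} [CommRing R] {φ : R ≃ ℕ}

/-! ### Density regularity -/

/-- Density regularity of a polynomial whose injective roots are invariant under the action of `S`
is witnessed by a finite list. -/
theorem density_regular_iff {S : Type*} [CommMonoid S] [IsCancelMul S] (φ : R ≃ ℕ) {ψ : S → R}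
    (hψ : Function.Injective ψ) (p : Poly R)
    (hp : ∀ (a : Fin (p.1 + 1) → S) (s : S), MvPolynomial.eval (fun i => ψ (a i)) p.2 = 0 →
      MvPolynomial.eval (fun i => ψ (s * a i)) p.2 = 0) (δ : ℝ) :
    (∀ B : Set R, δ ≤ upperBanachDensity (ψ ⁻¹' B) → ContainsInjectiveRoot p B) ↔
      ∃ L : List ℕ, (∀ n ∈ L, φ.symm n ∈ Set.range ψ) ∧ ∀ B ∈ L.sublists',
        δ * L.length ≤ B.length → ContainsInjectiveRoot p {x | φ x ∈ B} := by
  have : Countable S := (φ.injective.comp hψ).countable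
  let E : Set (Fin (p.1 + 1) → S) :=
    {a | Function.Injective a ∧ MvPolynomial.eval (fun i => ψ (a i)) p.2 = 0}
  have hE : ∀ e ∈ E, ∀ s : S, (fun i => s * e i) ∈ E := fun e he s =>
    ⟨fun i j hij => he.1 (mul_left_cancel hij), hp e s he.2⟩
  have hroot : ∀ B : Set R, B ⊆ Set.range ψ →
      (ContainsInjectiveRoot p B ↔ ∃ e ∈ E, ∀ i, ψ (e i) ∈ B) := by
    intro B hB
    constructor
    · rintro ⟨a, hinj, haB, ha⟩
      choose e he using fun i => hB (haB i)
      obtain rfl : (fun i => ψ (e i)) = a := funext he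
      exact ⟨e, ⟨hinj.of_comp, ha⟩, haB⟩
    · rintro ⟨e, ⟨hinj, he⟩, hB⟩
      exact ⟨_, hψ.comp hinj, hB, he⟩
  -- Only the part of `B` in the range of `ψ` affects the density, so `B` may be replaced by the
  -- image of a subset of `S`.
  have hleft : (∀ B : Set R, δ ≤ upperBanachDensity (ψ ⁻¹' B) → ContainsInjectiveRoot p B) ↔
      ∀ A : Set S, δ ≤ upperBanachDensity A → ∃ e ∈ E, ∀ i, e i ∈ A := by
    constructor
    · intro h A hA
      obtain ⟨e, he, hi⟩ := (hroot (ψ '' A) (Set.image_subset_range _ _)).1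
        (h _ (by rwa [Set.preimage_image_eq _ hψ]))
      exact ⟨e, he, fun i => (hψ.mem_set_image).1 (hi i)⟩
    · intro h B hB
      obtain ⟨e, ⟨hinj, he⟩, hi⟩ := h _ hB
      exact ⟨_, hψ.comp hinj, hi, he⟩
  rw [hleft, forall_density_iff_exists_list hE]
  -- Along this injection, lists over `S` become lists of numbers that code elements of the range of
  -- `ψ`.
  have hinj : Function.Injective fun s => φ (ψ s) := φ.injective.comp hψ
  have hlist : ∀ L : List S, (∀ B ∈ L.sublists', δ * L.length ≤ B.length →
      ∃ e ∈ E, ∀ i, e i ∈ B) ↔ ∀ B ∈ (L.map fun s => φ (ψ s)).sublists',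
        δ * (L.map fun s => φ (ψ s)).length ≤ B.length →
          ContainsInjectiveRoot p {x | φ x ∈ B} := by
    intro L
    rw [List.sublists'_map, List.forall_mem_map]
    refine forall₂_congr fun B _ => ?_
    rw [List.length_map, List.length_map, hroot]
    · refine imp_congr_right fun _ => exists_congr fun e => and_congr_right fun _ =>
        forall_congr' fun i => ?_
      exact (List.mem_map_of_injective hinj).symm
    · intro x hx
      obtain ⟨s, -, hs⟩ := List.mem_map.1 hx
      exact ⟨s, φ.injective hs⟩
  constructor
  · rintro ⟨L, hL⟩
    exact ⟨L.map fun s => φ (ψ s), by simp, (hlist L).1 hL⟩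
  · rintro ⟨M, hM, h⟩
    obtain ⟨L, rfl⟩ : ∃ L : List S, L.map (fun s => φ (ψ s)) = M := by
      have : M ∈ Set.range (List.map fun s => φ (ψ s)) := by
        rw [Set.range_list_map]
        intro n hn
        obtain ⟨s, hs⟩ := hM n hn
        exact ⟨s, by simp [hs]⟩
      exact this
    exact ⟨L, (hlist L).2 h⟩

/-- Common to the additive and multiplicative cases. The implication "dense enough, hence contains a
root" becomes the disjunction of `|B| < δ |L|` with a root search, so only an enumeration from below
of `δ` is needed. Taking `δ` as a sequence provides uniformity. -/
theorem sigmaOne_density (hφ : IsComputablePresentation φ) {S : Type*} [CommMonoid S]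
    [IsCancelMul S] {ψ : S → R} (hψ : Function.Injective ψ)
    (hrange : ComputablePred fun n => φ.symm n ∈ Set.range ψ) {Q : Set (Poly R)}
    (hQ : SigmaOne fun c : PolyCode => polyOfCode φ c ∈ Q)
    (hinv : ∀ p ∈ Q, ∀ (a : Fin (p.1 + 1) → S) (s : S),
      MvPolynomial.eval (fun i => ψ (a i)) p.2 = 0 →
        MvPolynomial.eval (fun i => ψ (s * a i)) p.2 = 0)
    {δ : ℕ → ℝ} (hδ : SigmaOne fun q : ℕ × ℕ × ℕ => (q.2.1 : ℝ) < δ q.1 * q.2.2) :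
    SigmaOne fun x : ℕ × PolyCode => (∀ B : Set R, δ x.1 ≤ upperBanachDensity (ψ ⁻¹' B) →
      ContainsInjectiveRoot (polyOfCode φ x.2) B) ∧ polyOfCode φ x.2 ∈ Q := by
  have h0 : SigmaOne fun y : ((ℕ × PolyCode) × List ℕ) × List ℕ =>
      (y.2.length : ℝ) < δ y.1.1.1 * y.1.2.length ∨
        ∃ l, (IsRootCode φ y.1.1.2 l ∧ l.Nodup) ∧ ∀ n ∈ l, n ∈ y.2 := by
    have hx : Computable fun y : ((ℕ × PolyCode) × List ℕ) × List ℕ => y.1.1 :=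
      Computable.fst.comp Computable.fst
    refine (hδ.comp ((Computable.fst.comp hx).pair ((Computable.list_length.comp
      Computable.snd).pair (Computable.list_length.comp
        (Computable.snd.comp Computable.fst))))).or ?_
    refine SigmaOne.exists_codable (p := fun z : (((ℕ × PolyCode) × List ℕ) × List ℕ) × List ℕ =>
      (IsRootCode φ z.1.1.1.2 z.2 ∧ z.2.Nodup) ∧ ∀ n ∈ z.2, n ∈ z.1.2)
      (SigmaOne.of_computablePred ?_)
    refine (((computablePred_isRootCode hφ).comp ((Computable.snd.comp
      (hx.comp Computable.fst)).pair Computable.snd)).and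
        (ComputablePred.nodup Computable.snd)).and ?_
    exact ComputablePred.forall_mem_list (ComputablePred.mem_list Computable.snd
      (Computable.snd.comp (Computable.fst.comp Computable.fst))) Computable.snd
  have h1 := h0.forall_mem_list (L := fun x : (ℕ × PolyCode) × List ℕ => x.2.sublists')
    (Primrec.list_sublists'.to_comp.comp Computable.snd)
  have h2 : SigmaOne fun x : (ℕ × PolyCode) × List ℕ => ∀ n ∈ x.2, φ.symm n ∈ Set.range ψ :=
    SigmaOne.of_computablePred
      ((hrange.comp Computable.snd).forall_mem_list Computable.snd)
  refine ((h2.and h1).exists_codable.and (hQ.comp Computable.snd)).of_eq fun x => ?_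
  -- The finite criterion needs invariance of the roots, which is available because the conjunct `Q`
  -- may be assumed.
  refine and_congr_left fun hxQ => ?_
  rw [density_regular_iff φ hψ _ (hinv _ hxQ)]
  refine exists_congr fun L => and_congr_right fun _ => forall₂_congr fun B _ => ?_
  rw [containsInjectiveRoot_iff, ← not_le, ← imp_iff_not_or]
  simp

theorem isCancelMul_nonZeroDivisors [IsDomain R] : IsCancelMul R⁰ where
  mul_left_cancel a _ _ h := Subtype.ext
    (mul_left_cancel₀ (nonZeroDivisors.coe_ne_zero a) (congrArg Subtype.val h))
  mul_right_cancel a _ _ h := Subtype.ext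
    (mul_right_cancel₀ (nonZeroDivisors.coe_ne_zero a) (congrArg Subtype.val h))

theorem sigmaOne_IMDRAt_inter_H [IsDomain R] (hφ : IsComputablePresentation φ)
    {δ : ℕ → ℝ} (hδ : SigmaOne fun q : ℕ × ℕ × ℕ => (q.2.1 : ℝ) < δ q.1 * q.2.2) :
    SigmaOne fun x : ℕ × PolyCode => polyOfCode φ x.2 ∈ IMDRAt R (δ x.1) ∩ H R := by
  have := isCancelMul_nonZeroDivisors (R := R)
  refine sigmaOne_density hφ (S := R⁰) (ψ := fun x => (x : R)) Subtype.val_injective ?_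
    (sigmaOne_mem_H hφ) ?_ hδ
  · refine (RComputable.eq (φ := φ) (RComputable.symm Computable.id) (RComputable.const 0)).not.of_eq
      fun n => ?_
    simp [mem_nonZeroDivisors_iff_ne_zero]
  · rintro p ⟨d, hd⟩ a s ha
    simp only [Submonoid.coe_mul]
    rw [hd.eval_mul_left, ha, mul_zero]

theorem sigmaOne_IADRAt_inter_T [IsDomain R] (hφ : IsComputablePresentation φ)
    {δ : ℕ → ℝ} (hδ : SigmaOne fun q : ℕ × ℕ × ℕ => (q.2.1 : ℝ) < δ q.1 * q.2.2) :
    SigmaOne fun x : ℕ × PolyCode => polyOfCode φ x.2 ∈ IADRAt R (δ x.1) ∩ T R := by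
  refine sigmaOne_density hφ (S := Multiplicative R) (ψ := Multiplicative.toAdd)
    Multiplicative.toAdd.injective ?_ (sigmaOne_mem_T hφ) ?_ hδ
  -- Every number codes an element of the range here, so a trivially true equation decides
  -- membership.
  · refine (ComputablePred.eq (Computable.const 0) (Computable.const 0)).of_eq fun n => ?_
    simp [Multiplicative.toAdd.surjective.range_eq]
  · rintro p hp a s ha
    have h := hp s.toAdd
    rw [← h, MvPolynomial.eval_aeval_X_add_C] at ha
    simpa only [toAdd_mul, add_comm] using ha

/-! ### Uniformity in the parameter and the `Π⁰₂` bounds -/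

theorem sigmaOne_lt_one_div : SigmaOne fun q : ℕ × ℕ × ℕ =>
    (q.2.1 : ℝ) < 1 / ((q.1 : ℝ) + 1) * q.2.2 := by
  refine SigmaOne.of_computablePred ((ComputablePred.lt
    (f := fun q : ℕ × ℕ × ℕ => q.2.1 * (q.1 + 1)) (g := fun q => q.2.2) ?_ ?_).of_eq fun q => ?_)
  · exact Primrec.nat_mul.to_comp.comp (Computable.fst.comp Computable.snd)
      (Computable.succ.comp Computable.fst)
  · exact Computable.snd.comp Computable.snd
  · rw [one_div_mul_eq_div, lt_div_iff₀ (by positivity)]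
    exact_mod_cast Iff.rfl

/-- Regularity at a smaller threshold is the stronger property, so thresholds tending to `0`
suffice. -/
theorem mem_IMDR_iff (p : Poly R) : p ∈ IMDR R ↔ ∀ n : ℕ, p ∈ IMDRAt R (1 / ((n : ℝ) + 1)) := by
  refine ⟨fun h n => h _ (by positivity), fun h δ hδ B hB => ?_⟩
  obtain ⟨n, hn⟩ := exists_nat_one_div_lt hδ
  exact h n B (hn.le.trans hB)

theorem mem_IADR_iff (p : Poly R) : p ∈ IADR R ↔ ∀ n : ℕ, p ∈ IADRAt R (1 / ((n : ℝ) + 1)) := by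
  refine ⟨fun h n => h _ (by positivity), fun h δ hδ B hB => ?_⟩
  obtain ⟨n, hn⟩ := exists_nat_one_div_lt hδ
  exact h n B (hn.le.trans hB)

theorem forall_one_le_iff {P : ℕ → Prop} : (∀ ℓ, 1 ≤ ℓ → P ℓ) ↔ ∀ n, P (n + 1) :=
  ⟨fun h n => h _ (Nat.le_add_left 1 n), fun h ℓ hℓ => by
    obtain ⟨n, rfl⟩ := Nat.exists_eq_add_of_le' hℓ
    exact h n⟩

theorem SigmaOne.isSigmaZeroPoly {P : ℕ → Set (Poly R)}
    (h : SigmaOne fun x : ℕ × PolyCode => polyOfCode φ x.2 ∈ P x.1) (n : ℕ) :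
    IsSigmaZeroPoly φ 1 (P n) :=
  h.comp ((Computable.const n).pair Computable.id)

theorem SigmaOne.isPiZeroPoly {P : ℕ → Set (Poly R)}
    (h : SigmaOne fun x : ℕ × PolyCode => polyOfCode φ x.2 ∈ P x.1) {A : Set (Poly R)}
    (hA : ∀ p, p ∈ A ↔ ∀ n, p ∈ P n) : IsPiZeroPoly φ 2 A :=
  isPiZero_two_of_forall (h.comp (Computable.snd.pair Computable.fst)) fun _ => hA _

end RamseyComplexity

theorem mainTheorem7 {R : Type*} [CommRing R] [IsDomain R] (φ : R ≃ ℕ)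
    (hφ : RamseyComplexity.IsComputablePresentation φ) :
    (∀ δ : ℝ, 0 < δ → RamseyComplexity.IsLowerSemicomputable δ →
      RamseyComplexity.IsSigmaZeroPoly φ 1
          (RamseyComplexity.IMDRAt R δ ∩ RamseyComplexity.H R) ∧
        RamseyComplexity.IsSigmaZeroPoly φ 1
          (RamseyComplexity.IADRAt R δ ∩ RamseyComplexity.T R)) ∧
    (∀ ℓ : ℕ, 1 ≤ ℓ →
      RamseyComplexity.IsSigmaZeroPoly φ 1 (RamseyComplexity.PRAt R ℓ) ∧
        RamseyComplexity.IsSigmaZeroPoly φ 1 (RamseyComplexity.IPRAt R ℓ)) ∧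
    (RamseyComplexity.IsPiZeroPoly φ 2 (RamseyComplexity.IMDR R ∩ RamseyComplexity.H R) ∧
      RamseyComplexity.IsPiZeroPoly φ 2 (RamseyComplexity.IADR R ∩ RamseyComplexity.T R) ∧
      RamseyComplexity.IsPiZeroPoly φ 2 (RamseyComplexity.PR R) ∧
      RamseyComplexity.IsPiZeroPoly φ 2 (RamseyComplexity.IPR R)) := by
  open RamseyComplexity in
  refine ⟨fun δ _ hδ => ?_, ?_, ?_, ?_, ?_, ?_⟩
  · have hδ' : SigmaOne fun q : ℕ × ℕ × ℕ => (q.2.1 : ℝ) < δ * q.2.2 :=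
      SigmaOne.comp (p := fun q : ℕ × ℕ => (q.1 : ℝ) < δ * q.2) hδ Computable.snd
    exact ⟨(sigmaOne_IMDRAt_inter_H hφ (δ := fun _ => δ) hδ').isSigmaZeroPoly
        (P := fun _ => IMDRAt R δ ∩ H R) 0,
      (sigmaOne_IADRAt_inter_T hφ (δ := fun _ => δ) hδ').isSigmaZeroPoly
        (P := fun _ => IADRAt R δ ∩ T R) 0⟩
  · exact forall_one_le_iff.2 fun n =>
      ⟨(sigmaOne_PRAt hφ).isSigmaZeroPoly (P := fun n => PRAt R (n + 1)) n,
        (sigmaOne_IPRAt hφ).isSigmaZeroPoly (P := fun n => IPRAt R (n + 1)) n⟩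
  -- The factor `H R` does not depend on `n`, so it may be kept inside the intersection, where each
  -- level needs it to be `Σ⁰₁`.
  · refine SigmaOne.isPiZeroPoly (P := fun n : ℕ => IMDRAt R (1 / ((n : ℝ) + 1)) ∩ H R)
      (sigmaOne_IMDRAt_inter_H hφ (δ := fun n => 1 / ((n : ℝ) + 1)) sigmaOne_lt_one_div) fun p => ?_
    simp only [Set.mem_inter_iff, forall_and, mem_IMDR_iff, forall_const]
  · refine SigmaOne.isPiZeroPoly (P := fun n : ℕ => IADRAt R (1 / ((n : ℝ) + 1)) ∩ T R)
      (sigmaOne_IADRAt_inter_T hφ (δ := fun n => 1 / ((n : ℝ) + 1)) sigmaOne_lt_one_div) fun p => ?_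
    simp only [Set.mem_inter_iff, forall_and, mem_IADR_iff, forall_const]
  · exact SigmaOne.isPiZeroPoly (P := fun n => PRAt R (n + 1)) (sigmaOne_PRAt hφ)
      fun p => forall_one_le_iff
  · exact SigmaOne.isPiZeroPoly (P := fun n => IPRAt R (n + 1)) (sigmaOne_IPRAt hφ)
      fun p => forall_one_le_iff
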